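/- Conventions. An $N\times N$ matrix $W$ of (complex) Borel measures on $\mathbb R$ is a weight matrix if $W(\Omega)$ is positive semidefinite for every Borel set $\Omega$, all moments $\int t^n\,dW(t)$ exist and are finite, and $\int P\,dW\,P^*$ is nonsingular for every matrix polynomial $P$ with nonsingular leading coefficient. For matrix polynomials $P,Q\in\mathbb C^{N\times N}[t]$ put $\langle P,Q\rangle_W=\int P(t)\,dW(t)\,Q(t)^*$. A differential operator $D=\partial^2F_2(t)+\partial^1F_1(t)+\partial^0F_0(t)$, with matrix polynomial coefficients, acts on the right by $PD=P''F_2+P'F_1+PF_0$; it is symmetric with respect to $W$ if $\langle PD,Q\rangle_W=\langle P,QD\rangle_W$ for all matrix polynomials $P,Q$. Let $N\ge 2$, $\alpha>-1$, and $\nu_1,\dots,\nu_{N-1}\in\mathbb R\setminus\{0\}$. Let $E_{ij}$ be the matrix units, and put $$J=\sum_{i=1}^N(N-i)E_{ii},\qquad A=\sum_{i=1}^{N-1}\nu_iE_{i,i+1},\qquad Y=\sum_{i=1}^{N-1}\frac{i(N-i)}{\nu_i}E_{i+1,i},$$ $$W(t)=t^\alpha e^{-t}e^{At}\,t^{\frac12J}\,t^{\frac12J^*}e^{A^*t},\qquad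 t\in(0,\infty),$$ where $t^B=e^{B\log t}$. Consider the operators $$D_1=\partial^2\,tI+\partial^1\,[(\alpha+1)I+J+t(A-I)]+\partial^0\,[(J+\alpha I)A-J],\qquad D_2=\partial^2G_2(t)+\partial^1G_1(t)+\partial^0G_0,$$ $$G_2=t(J-At),\qquad G_1=((1+\alpha)I+J)J+Y-t\,(J+(\alpha+2)A+Y^*-AY+YA),\qquad G_0=\frac{N-1}{\nu_{N-1}^2}\,[J-(\alpha I+J)A],$$ and $$D=-(N-1)D_1+D_2.$$ Let $v$ be the row vector with entries $v_j=\prod_{k=1}^{N-j}\frac{\nu_{N-k}(\alpha+k)}{k}$, $1\le j\le N$ (so $v_N=1$), and let $M=v^*v$. Then: 1. $W$ is integrable on $(0,\infty)$, $W(t)\,dt$ is a weight matrix, and $D_1$ is symmetric with respect to it. 2. $M$ is Hermitian positive semidefinite and singular, and $$M_{ij}=\Big(\prod_{k=\min\{i,j\}}^{\max\{i,j\}-1}\frac{\nu_k(\alpha+N-k)}{N-k}\Big)\Big(\prod_{k=1}^{N-\max\{i,j\}}\frac{\nu_{N-k}(\alpha+k)}{k}\Big)^2,\qquad 1\le i,j\le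 N.$$ 3. Suppose in addition that $$i(N-i)\nu_{N-1}^2=(N-1)\nu_i^2+(N-i-1)\nu_i^2\nu_{N-1}^2,\qquad i=1,\dots,N-2.$$ Then $D_2$ is symmetric with respect to $W(t)\,dt$; the coefficients of $D=\partial^2F_2+\partial^1F_1+\partial^0F_0$ are $$F_2=t\,(-(N-1)I+J-At),\qquad F_1=Y-\sum_{i=1}^N(i-1)(\alpha+N-i+1)E_{ii}+t\,(J-(\alpha+N+1)A-Y^*),$$ $$F_0=\frac{(N-1)(1+\nu_{N-1}^2)}{\nu_{N-1}^2}\,[J-(\alpha I+J)A];$$ and for all $\gamma>0$ and $\zeta\ge0$ the matrix of measures $$\gamma\,W(t)\chi_{(0,\infty)}(t)\,dt+\zeta\,\delta_0M$$ is a weight matrix with respect to which $D$ is symmetric. -/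

import Mathlib

open MeasureTheory Polynomial Matrix
open scoped ComplexOrder

noncomputable section

namespace MatrixWeight

/-! ### Matrix polynomials, matrices of measures, differential operators -/

/-- Matrix polynomials of size `N × N` with complex coefficients. -/
abbrev MatPoly (N : ℕ) := Matrix (Fin N) (Fin N) ℂ[X]

/-- An `N × N` matrix of (complex) Borel measures on the real line. -/
abbrev MatMeasure (N : ℕ) := Matrix (Fin N) (Fin N) (ComplexMeasure ℝ)

/-- A right-hand side differential operator `D = ∑_{i ≤ k} ∂^i F_i(t)` of order at most `k`,
given by its matrix polynomial coefficients `F_0, …, F_k`. -/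
abbrev DiffOp (k N : ℕ) := Fin (k + 1) → MatPoly N

variable {N : ℕ}

/-- The constant matrix polynomial `B`. -/
def const (B : Matrix (Fin N) (Fin N) ℂ) : MatPoly N := B.map C

/-- The right action `P D = ∑_{i ≤ k} P^{(i)}(t) F_i(t)`. -/
def applyRight {k : ℕ} (P : MatPoly N) (D : DiffOp k N) : MatPoly N :=
  ∑ i : Fin (k + 1), P.map (fun p => derivative^[(i : ℕ)] p) * D i

/-- The matrix valued form `⟨P, Q⟩ = ∫ P(t) dW(t) Q(t)^*`, whose `(i, j)` entry is
`∑_{k, l} ∫ P_{ik}(t) conj (Q_{jl}(t)) dW_{kl}(t)`. -/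
def form (W : MatMeasure N) (P Q : MatPoly N) : Matrix (Fin N) (Fin N) ℂ :=
  Matrix.of fun i j => ∑ k, ∑ l,
    (W k l).integral (fun t : ℝ => (P i k).eval (t : ℂ) * star ((Q j l).eval (t : ℂ)))
      (ContinuousLinearMap.mul ℝ ℂ)

/-- Weight matrices: `W(Ω)` is positive semidefinite for every Borel set `Ω`, all the moments
exist, and `⟨P, P⟩` is nonsingular whenever the leading coefficient of `P` is nonsingular. -/
structure IsWeightMatrix (W : MatMeasure N) : Prop where
  posSemidef : ∀ Ω : Set ℝ, MeasurableSet Ω → (W.map fun m => m Ω).PosSemidef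
  moments : ∀ (n : ℕ) (i j : Fin N), (W i j).Integrable (fun t : ℝ => (t : ℂ) ^ n)
  nonsingular : ∀ (n : ℕ) (P : MatPoly N), (∀ i j, (P i j).natDegree ≤ n) →
    IsUnit (P.map fun p => p.coeff n) → IsUnit (form W P P)

/-- `D` is symmetric with respect to `W`: `⟨P D, Q⟩ = ⟨P, Q D⟩` for all matrix polynomials. -/
def IsSymmetric {k : ℕ} (D : DiffOp k N) (W : MatMeasure N) : Prop :=
  ∀ P Q : MatPoly N, form W (applyRight P D) Q = form W P (applyRight Q D)

/-- The matrix of measures `w(t) dt` on the set `S`. -/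
def ofDensity (S : Set ℝ) (w : ℝ → Matrix (Fin N) (Fin N) ℂ) : MatMeasure N :=
  Matrix.of fun i j => (volume.restrict S).withDensityᵥ fun t => w t i j

/-- The matrix of measures `δ_{t₀} M`. -/
def diracMass (t₀ : ℝ) (M : Matrix (Fin N) (Fin N) ℂ) : MatMeasure N :=
  M.map fun c => VectorMeasure.dirac t₀ c

/-- `t ^ B = exp (B log t)` for `t > 0`. -/
def matPow (t : ℝ) (B : Matrix (Fin N) (Fin N) ℂ) : Matrix (Fin N) (Fin N) ℂ :=
  NormedSpace.exp ((Real.log t : ℂ) • B)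

/-! ### The matrices of the example

The parameters are `ν 1, …, ν (N - 1)`.  A row or column index `i : Fin N` stands for
the index `i + 1` in `{1, …, N}`. -/

/-- `J = ∑_{i=1}^{N} (N - i) E_{ii}`. -/
def matJ (N : ℕ) : Matrix (Fin N) (Fin N) ℂ :=
  Matrix.diagonal fun i => (N : ℂ) - ((i : ℕ) + 1)

/-- `A = ∑_{i=1}^{N-1} ν_i E_{i,i+1}`. -/
def matA (N : ℕ) (ν : ℕ → ℝ) : Matrix (Fin N) (Fin N) ℂ :=
  Matrix.of fun i j => if (j : ℕ) = (i : ℕ) + 1 then (ν ((i : ℕ) + 1) : ℂ) else 0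

/-- `Y = ∑_{i=1}^{N-1} (i (N - i) / ν_i) E_{i+1,i}`. -/
def matY (N : ℕ) (ν : ℕ → ℝ) : Matrix (Fin N) (Fin N) ℂ :=
  Matrix.of fun i j =>
    if (i : ℕ) = (j : ℕ) + 1 then
      ((j : ℕ) + 1 : ℂ) * ((N : ℂ) - ((j : ℕ) + 1)) / (ν ((j : ℕ) + 1) : ℂ)
    else 0

/-- `W(t) = t^α e^{-t} e^{At} t^{J/2} t^{J^*/2} e^{A^* t}`. -/
def density (N : ℕ) (α : ℝ) (ν : ℕ → ℝ) (t : ℝ) : Matrix (Fin N) (Fin N) ℂ :=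
  ((t ^ α * Real.exp (-t) : ℝ) : ℂ) •
    (NormedSpace.exp ((t : ℂ) • matA N ν) * matPow t ((1 / 2 : ℂ) • matJ N) *
      matPow t ((1 / 2 : ℂ) • (matJ N)ᴴ) * NormedSpace.exp ((t : ℂ) • (matA N ν)ᴴ))

/-- The matrix of measures `W(t) dt` on `(0, ∞)`. -/
def weight (N : ℕ) (α : ℝ) (ν : ℕ → ℝ) : MatMeasure N :=
  ofDensity (Set.Ioi 0) (density N α ν)

/-- `D₁ = ∂² tI + ∂¹ [(α+1)I + J + t(A - I)] + ∂⁰ [(J + αI)A - J]`. -/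
def opD₁ (N : ℕ) (α : ℝ) (ν : ℕ → ℝ) : DiffOp 2 N :=
  ![const ((matJ N + (α : ℂ) • 1) * matA N ν - matJ N),
    const (((α : ℂ) + 1) • 1 + matJ N) + (X : ℂ[X]) • const (matA N ν - 1),
    (X : ℂ[X]) • const 1]

/-- `D₂ = ∂² G₂(t) + ∂¹ G₁(t) + ∂⁰ G₀` with `G₂ = t(J - At)`,
`G₁ = ((1+α)I + J)J + Y - t(J + (α+2)A + Y^* - AY + YA)` and
`G₀ = (N-1)/ν_{N-1}² [J - (αI + J)A]`. -/
def opD₂ (N : ℕ) (α : ℝ) (ν : ℕ → ℝ) : DiffOp 2 N :=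
  ![const ((((N : ℂ) - 1) / (ν (N - 1) : ℂ) ^ 2) •
      (matJ N - ((α : ℂ) • 1 + matJ N) * matA N ν)),
    const (((1 + (α : ℂ)) • 1 + matJ N) * matJ N + matY N ν) -
      (X : ℂ[X]) • const (matJ N + ((α : ℂ) + 2) • matA N ν + (matY N ν)ᴴ -
        matA N ν * matY N ν + matY N ν * matA N ν),
    (X : ℂ[X]) • (const (matJ N) - (X : ℂ[X]) • const (matA N ν))]

/-- `D = -(N-1) D₁ + D₂`. -/
def opD (N : ℕ) (α : ℝ) (ν : ℕ → ℝ) : DiffOp 2 N :=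
  -((N : ℂ) - 1) • opD₁ N α ν + opD₂ N α ν

/-- The row vector `v = ∑_{j=1}^{N-1} (∏_{k=1}^{N-j} ν_{N-k} (α + k) / k) e_j + e_N`
(for `j = N` the product is empty). -/
def vecV (N : ℕ) (α : ℝ) (ν : ℕ → ℝ) : Fin N → ℂ :=
  fun j => ∏ k ∈ Finset.Icc 1 (N - ((j : ℕ) + 1)), (ν (N - k) : ℂ) * ((α : ℂ) + k) / k

/-- `M = v^* v`. -/
def massM (N : ℕ) (α : ℝ) (ν : ℕ → ℝ) : Matrix (Fin N) (Fin N) ℂ :=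
  Matrix.vecMulVec (star (vecV N α ν)) (vecV N α ν)

end MatrixWeight

end

open MatrixWeight

/-! Since `A` is nilpotent, `T(t) = e^{At}` is a matrix polynomial with polynomial inverse, and `W =
T diag(t^{β_m} e^{-t}) T^*` with `β_m = α + N - m`. Hence `P ↦ PT` turns `⟨P, Q⟩_W` into a sum of
scalar Laguerre forms (`form_weight`): moments and positivity reduce to the scalar weight, and
symmetry of `D` reduces to symmetry, for the diagonal weight, of the operator `E` with `(PD)T =
(PT)E` (`applyRight_mul_expPoly`, `isSymmetric_weight`).

The relations `[J, A] = A` and `[Y, A] = (N-1)I - 2J`, of `sl₂` type, make conjugation by `T`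
explicit: `J` becomes `J + tA`, and `Y` becomes `Y - t(2J - (N-1)I) - t²A`. For `D₁` the operator
`E` is diagonal, made of the Laguerre operators `t∂² + (β_m + 1 - t)∂` and constants. For `D₂` it is
a diagonal operator plus `∂Y` plus the formal adjoint of `∂Y`. That adjoint contains `Y^*`, and the
condition on the `ν_i` enters only as `Y^* = A(J + cI)`, `c = (N-1)/ν_{N-1}²`
(`conjTranspose_matY_eq`), which makes the coefficients match.

The mass contributes `(PD)(0) M Q(0)^*` to `⟨PD, Q⟩`. It vanishes on both sides once `F_k(0) M = 0`
for all `k`, `M` being Hermitian (`isSymmetric_add_diracMass`). Here `F_2(0) = 0`, while `F_1(0) v^*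
= 0` and `F_0 v^* = 0` both follow from the recurrence `(N-i) v_i = ν_i (α+N-i) v_{i+1}`
(`vecV_succ_eq`). -/

namespace MatrixWeight

/-! ### Integration against a complex measure with density -/

section VectorMeasures

variable {X : Type*} [MeasurableSpace X] {μ : Measure X} {g : X → ℂ}

theorem integrable_withDensityᵥ_iff (hg : Integrable g μ) {f : X → ℂ} :
    (μ.withDensityᵥ g).Integrable f ↔ Integrable (fun x => ‖g x‖ • f x) μ := by
  rw [VectorMeasure.Integrable, Measure.variation_withDensityᵥ hg,
    integrable_withDensity_iff_integrable_smul₀' hg.aestronglyMeasurable.enorm (by simp)]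
  simp

theorem integrable_norm_smul_iff (hg : Integrable g μ) {f : X → ℂ}
    (hf : AEStronglyMeasurable f μ) :
    Integrable (fun x => ‖g x‖ • f x) μ ↔ Integrable (fun x => f x * g x) μ := by
  refine integrable_congr' (hg.aestronglyMeasurable.norm.smul hf)
    (hf.mul hg.aestronglyMeasurable) (.of_forall fun x => ?_)
  simp [mul_comm]

/-- No measurability of `f` for `μ` is available, only that of `‖g‖ f`; the product `f g` is
recovered from it through the phase `g / ‖g‖`, bounded by one. -/
theorem Integrable.mul_of_norm_smul (hg : Integrable g μ) {f : X → ℂ}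
    (hf : Integrable (fun x => ‖g x‖ • f x) μ) : Integrable (fun x => f x * g x) μ := by
  have hs : AEStronglyMeasurable (fun x => (‖g x‖ : ℂ)⁻¹ * g x) μ :=
    ((Complex.measurable_ofReal.comp_aemeasurable hg.aestronglyMeasurable.norm.aemeasurable).inv.mul
      hg.aestronglyMeasurable.aemeasurable).aestronglyMeasurable
  have he : (fun x => f x * g x) = fun x => (‖g x‖ • f x) * ((‖g x‖ : ℂ)⁻¹ * g x) := by
    funext x
    rcases eq_or_ne (g x) 0 with h | h
    · simp [h]
    · have : (‖g x‖ : ℂ) ≠ 0 := by simpa using h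
      simp only [Complex.real_smul]
      field_simp
  rw [he]
  refine hf.mul_bdd (c := 1) hs (.of_forall fun x => ?_)
  rcases eq_or_ne (g x) 0 with h | h
  · simp [h]
  · simp [h]

/-- Both sides are additive and continuous in `f` for the `L¹` norm of the variation `‖g‖ μ`, and
they agree on indicators. -/
theorem integral_withDensityᵥ (hg : Integrable g μ) {f : X → ℂ}
    (hf : (μ.withDensityᵥ g).Integrable f) :
    (μ.withDensityᵥ g).integral f (ContinuousLinearMap.mul ℝ ℂ) = ∫ x, f x * g x ∂μ := by
  have hmul : ∀ {f : X → ℂ}, (μ.withDensityᵥ g).Integrable f →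
      Integrable (fun x => f x * g x) μ := fun h =>
    Integrable.mul_of_norm_smul hg ((integrable_withDensityᵥ_iff hg).1 h)
  have hlint : ∀ {f : X → ℂ}, AEStronglyMeasurable f (μ.withDensityᵥ g).variation →
      ∫⁻ x, ‖f x * g x‖ₑ ∂μ = ∫⁻ x, ‖f x‖ₑ ∂(μ.withDensityᵥ g).variation := by
    intro f hf
    rw [Measure.variation_withDensityᵥ hg] at hf ⊢
    rw [lintegral_withDensity_eq_lintegral_mul₀' hg.aestronglyMeasurable.enorm hf.enorm]
    simp [enorm_mul, mul_comm]
  have hae : ∀ {f₁ f₂ : X → ℂ}, f₁ =ᵐ[(μ.withDensityᵥ g).variation] f₂ →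
      (fun x => f₁ x * g x) =ᵐ[μ] fun x => f₂ x * g x := by
    intro f₁ f₂ h
    rw [Measure.variation_withDensityᵥ hg, Filter.EventuallyEq,
      ae_withDensity_iff' hg.aestronglyMeasurable.enorm] at h
    filter_upwards [h] with x hx
    rcases eq_or_ne (g x) 0 with h0 | h0
    · simp [h0]
    · rw [hx (by simpa using h0)]
  refine MeasureTheory.Integrable.induction
    (P := fun f => (μ.withDensityᵥ g).integral f (ContinuousLinearMap.mul ℝ ℂ)
      = ∫ x, f x * g x ∂μ) ?_ ?_ ?_ ?_ hf
  · intro c s hs hμ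
    have : IsFiniteMeasure ((μ.withDensityᵥ g).variation.restrict s) :=
      ⟨by simpa using hμ⟩
    rw [VectorMeasure.integral_indicator hs, VectorMeasure.setIntegral_const,
      withDensityᵥ_apply hg hs, ContinuousLinearMap.mul_apply', ← integral_const_mul,
      ← integral_indicator hs]
    congr 1
    funext x
    by_cases hx : x ∈ s <;> simp [hx]
  · intro f₁ f₂ _ h₁ h₂ e₁ e₂
    rw [VectorMeasure.integral_add h₁ h₂, e₁, e₂, ← integral_add (hmul h₁) (hmul h₂)]
    simp [add_mul]
  · refine isClosed_eq VectorMeasure.continuous_integral ?_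
    refine LipschitzWith.continuous (K := 1) fun f₁ f₂ => ?_
    rw [ENNReal.coe_one, one_mul, Lp.edist_def, eLpNorm_one_eq_lintegral_enorm, edist_eq_enorm_sub,
      ← integral_sub (hmul (L1.integrable_coeFn f₁)) (hmul (L1.integrable_coeFn f₂))]
    refine (enorm_integral_le_lintegral_enorm _).trans (le_of_eq ?_)
    rw [← hlint ((L1.integrable_coeFn f₁).sub (L1.integrable_coeFn f₂)).aestronglyMeasurable]
    simp [sub_mul]
  · intro f₁ f₂ h _ e
    rw [← VectorMeasure.integral_congr_ae h, e, integral_congr_ae (hae h)]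

end VectorMeasures

/-! ### The scalar Laguerre functional -/

section Laguerre

/-- The moment functional `p ↦ ∫_0^∞ p(t) t^β e^{-t} dt` of the Laguerre weight. -/
noncomputable def laguerre (β : ℝ) : ℂ[X] →ₗ[ℂ] ℂ :=
  lsum fun n => (Real.Gamma (β + n + 1) : ℂ) • LinearMap.id

/-- The polynomial with conjugate coefficients. -/
noncomputable def conjPoly : ℂ[X] →+* ℂ[X] := mapRingHom (starRingEnd ℂ)

/-- The Laguerre weight `t^β e^{-t}`, as a complex number. -/
noncomputable def laguerreDensity (β t : ℝ) : ℂ := ((t ^ β * Real.exp (-t) : ℝ) : ℂ)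

theorem laguerre_monomial (β : ℝ) (n : ℕ) (c : ℂ) :
    laguerre β (monomial n c) = Real.Gamma (β + n + 1) * c := by
  simp [laguerre, lsum_apply, sum_monomial_index]

theorem integrableOn_pow_mul_laguerreDensity {β : ℝ} (hβ : -1 < β) (n : ℕ) :
    IntegrableOn (fun t : ℝ => (t : ℂ) ^ n * laguerreDensity β t) (Set.Ioi 0) := by
  have h := (Real.GammaIntegral_convergent (s := β + n + 1)
    (by have : (0 : ℝ) ≤ n := n.cast_nonneg; linarith)).ofReal (𝕜 := ℂ)
  refine IntegrableOn.congr_fun h (fun t ht => ?_) measurableSet_Ioi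
  have ht' : (0 : ℝ) < t := ht
  simp only [laguerreDensity, add_sub_cancel_right, Real.rpow_add ht', Real.rpow_natCast]
  simp
  ring

theorem integral_pow_mul_laguerreDensity {β : ℝ} (hβ : -1 < β) (n : ℕ) :
    ∫ t in Set.Ioi (0 : ℝ), (t : ℂ) ^ n * laguerreDensity β t = Real.Gamma (β + n + 1) := by
  rw [Real.Gamma_eq_integral (by have : (0 : ℝ) ≤ n := n.cast_nonneg; linarith),
    ← integral_complex_ofReal]
  refine setIntegral_congr_fun measurableSet_Ioi fun t ht => ?_
  have ht' : (0 : ℝ) < t := ht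
  simp only [laguerreDensity, add_sub_cancel_right, Real.rpow_add ht', Real.rpow_natCast]
  push_cast
  ring

theorem integrableOn_eval_mul_laguerreDensity {β : ℝ} (hβ : -1 < β) (p : ℂ[X]) :
    IntegrableOn (fun t : ℝ => p.eval (t : ℂ) * laguerreDensity β t) (Set.Ioi 0) := by
  induction p using Polynomial.induction_on' with
  | add p q hp hq => simpa [add_mul] using! hp.add hq
  | monomial n c =>
    simpa [mul_assoc] using! (integrableOn_pow_mul_laguerreDensity hβ n).const_mul c

theorem laguerre_eq_integral {β : ℝ} (hβ : -1 < β) (p : ℂ[X]) :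
    laguerre β p = ∫ t in Set.Ioi (0 : ℝ), p.eval (t : ℂ) * laguerreDensity β t := by
  induction p using Polynomial.induction_on' with
  | add p q hp hq =>
    rw [map_add, hp, hq, ← integral_add (integrableOn_eval_mul_laguerreDensity hβ p)
      (integrableOn_eval_mul_laguerreDensity hβ q)]
    simp [add_mul]
  | monomial n c =>
    simp only [laguerre_monomial, eval_monomial, mul_assoc]
    rw [integral_const_mul, integral_pow_mul_laguerreDensity hβ, mul_comm]

theorem laguerre_X_mul (β : ℝ) (p : ℂ[X]) : laguerre β (X * p) = laguerre (β + 1) p := by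
  induction p using Polynomial.induction_on' with
  | add p q hp hq => simp [mul_add, hp, hq]
  | monomial n c =>
    rw [X_mul_monomial, laguerre_monomial, laguerre_monomial]
    push_cast
    ring_nf

/-- Integration by parts against the Laguerre weight. -/
theorem laguerre_X_mul_derivative {β : ℝ} (hβ : -1 < β) (p : ℂ[X]) :
    laguerre β (X * derivative p) = laguerre β (X * p) - (β + 1) * laguerre β p := by
  induction p using Polynomial.induction_on' with
  | add p q hp hq => simp only [mul_add, map_add, hp, hq]; ring
  | monomial n c =>
    have hpos : β + n + 1 ≠ 0 := by have : (0 : ℝ) ≤ n := n.cast_nonneg; linarith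
    have hG : (Real.Gamma (β + (n + 1 : ℕ) + 1) : ℂ)
        = (β + n + 1) * Real.Gamma (β + n + 1) := by
      rw [show β + ((n + 1 : ℕ) : ℝ) + 1 = β + n + 1 + 1 by push_cast; ring,
        Real.Gamma_add_one hpos]
      push_cast
      ring
    have hd : X * derivative (monomial n c) = monomial n (n * c) := by
      rcases n with _ | n
      · simp
      · rw [derivative_monomial, X_mul_monomial]
        simp [mul_comm]
    rw [hd, X_mul_monomial, laguerre_monomial, laguerre_monomial, laguerre_monomial, hG]
    ring

theorem eval_conjPoly (p : ℂ[X]) (t : ℝ) : (conjPoly p).eval (t : ℂ) = star (p.eval (t : ℂ)) := by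
  have := Polynomial.eval_map_apply (starRingEnd ℂ) (p := p) (t : ℂ)
  simpa [conjPoly] using this

theorem laguerreDensity_nonneg (β : ℝ) {t : ℝ} (ht : 0 < t) : 0 ≤ laguerreDensity β t := by
  rw [laguerreDensity, Complex.zero_le_real]
  positivity

theorem laguerre_mul_conjPoly_nonneg {β : ℝ} (hβ : -1 < β) (p : ℂ[X]) :
    0 ≤ laguerre β (p * conjPoly p) := by
  rw [laguerre_eq_integral hβ]
  refine integral_nonneg_of_ae ((ae_restrict_iff' measurableSet_Ioi).2 <| .of_forall fun t ht => ?_)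
  simp only [Pi.zero_apply]
  rw [eval_mul, eval_conjPoly]
  exact mul_nonneg (mul_star_self_nonneg _) (laguerreDensity_nonneg β ht)

/-- If the integral of the nonnegative integrand were zero, `p` would vanish almost everywhere on
the half-line, whereas it has finitely many roots. -/
theorem laguerre_mul_conjPoly_pos {β : ℝ} (hβ : -1 < β) {p : ℂ[X]} (hp : p ≠ 0) :
    0 < laguerre β (p * conjPoly p) := by
  refine lt_of_le_of_ne (laguerre_mul_conjPoly_nonneg hβ p) fun h => hp ?_
  have hI := integrableOn_eval_mul_laguerreDensity hβ (p * conjPoly p)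
  rw [laguerre_eq_integral hβ] at h
  have hre : ∫ t in Set.Ioi (0 : ℝ),
      ((p * conjPoly p).eval (t : ℂ) * laguerreDensity β t).re = 0 := by
    have := integral_re hI
    simp only [RCLike.re_to_complex] at this
    rw [this, ← h]
    simp
  have hnn : ∀ t : ℝ, 0 < t → 0 ≤ ((p * conjPoly p).eval (t : ℂ) * laguerreDensity β t) := by
    intro t ht
    rw [eval_mul, eval_conjPoly]
    exact mul_nonneg (mul_star_self_nonneg _) (laguerreDensity_nonneg β ht)
  rw [integral_eq_zero_iff_of_nonneg_ae
    ((ae_restrict_iff' measurableSet_Ioi).2 <| .of_forall fun t ht =>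
      (Complex.le_def.1 (hnn t ht)).1) hI.re] at hre
  have hz : ∀ᵐ t : ℝ ∂(volume.restrict (Set.Ioi (0 : ℝ))), p.eval (t : ℂ) = 0 := by
    filter_upwards [hre, ae_restrict_mem measurableSet_Ioi] with t h0 ht
    have ht' : (0 : ℝ) < t := ht
    have h1 : (p * conjPoly p).eval (t : ℂ) * laguerreDensity β t = 0 :=
      Complex.ext h0 (Complex.le_def.1 (hnn t ht)).2.symm
    have h2 : laguerreDensity β t ≠ 0 := by
      rw [laguerreDensity, Complex.ofReal_ne_zero]
      positivity
    rw [eval_mul, eval_conjPoly] at h1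
    simpa [h2] using h1
  by_contra hp0
  have hfin : {t : ℝ | p.eval (t : ℂ) = 0}.Finite :=
    Set.Finite.preimage (Complex.ofReal_injective.injOn) (Polynomial.finite_setOfPred_isRoot hp0)
  have h0 : volume.restrict (Set.Ioi (0 : ℝ)) = 0 := by
    have : volume.restrict (Set.Ioi (0 : ℝ)) Set.univ = 0 := by
      rw [← Set.union_compl_self {t : ℝ | p.eval (t : ℂ) = 0}]
      refine measure_union_null ?_ hz
      exact Measure.absolutelyContinuous_of_le Measure.restrict_le_self (hfin.measure_zero volume)
    exact Measure.measure_univ_eq_zero.1 this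
  simp at h0

end Laguerre

/-! ### Calculus of matrix polynomials -/

section Calculus

variable {N : ℕ}

/-- The entrywise derivative of a matrix polynomial. -/
noncomputable def matDeriv (P : MatPoly N) : MatPoly N := P.map derivative

theorem const_eq_mapMatrix (B : Matrix (Fin N) (Fin N) ℂ) : const B = C.mapMatrix B := rfl

theorem const_add (B B' : Matrix (Fin N) (Fin N) ℂ) : const (B + B') = const B + const B' := by
  simp only [const_eq_mapMatrix, map_add]

theorem const_sub (B B' : Matrix (Fin N) (Fin N) ℂ) : const (B - B') = const B - const B' := by
  simp only [const_eq_mapMatrix, map_sub]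

theorem const_neg (B : Matrix (Fin N) (Fin N) ℂ) : const (-B) = -const B := by
  simp only [const_eq_mapMatrix, map_neg]

theorem const_mul (B B' : Matrix (Fin N) (Fin N) ℂ) : const (B * B') = const B * const B' := by
  simp only [const_eq_mapMatrix, map_mul]

theorem const_pow (B : Matrix (Fin N) (Fin N) ℂ) (n : ℕ) : const (B ^ n) = const B ^ n := by
  simp only [const_eq_mapMatrix, map_pow]

theorem const_one : const (1 : Matrix (Fin N) (Fin N) ℂ) = 1 := by
  simp only [const_eq_mapMatrix, map_one]

theorem const_zero : const (0 : Matrix (Fin N) (Fin N) ℂ) = 0 := by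
  simp only [const_eq_mapMatrix, map_zero]

theorem const_smul (c : ℂ) (B : Matrix (Fin N) (Fin N) ℂ) : const (c • B) = C c • const B := by
  ext i j : 2
  simp [const]

theorem const_diagonal (d : Fin N → ℂ) : const (diagonal d) = diagonal fun i => C (d i) := by
  ext i j : 2
  by_cases h : i = j <;> simp [const, h]

theorem matDeriv_add (P Q : MatPoly N) : matDeriv (P + Q) = matDeriv P + matDeriv Q := by
  ext i j : 2
  simp [matDeriv]

theorem matDeriv_sub (P Q : MatPoly N) : matDeriv (P - Q) = matDeriv P - matDeriv Q := by
  ext i j : 2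
  simp [matDeriv]

theorem matDeriv_mul (P Q : MatPoly N) : matDeriv (P * Q) = matDeriv P * Q + P * matDeriv Q := by
  ext i j : 2
  simp [matDeriv, mul_apply, Finset.sum_add_distrib]

theorem matDeriv_const (B : Matrix (Fin N) (Fin N) ℂ) : matDeriv (const B) = 0 := by
  ext i j : 2
  simp [matDeriv, const]

theorem matDeriv_smul_const (p : ℂ[X]) (B : Matrix (Fin N) (Fin N) ℂ) :
    matDeriv (p • const B) = derivative p • const B := by
  ext i j : 2
  simp [matDeriv, const]

theorem matDeriv_sum {ι : Type*} (s : Finset ι) (P : ι → MatPoly N) :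
    matDeriv (∑ i ∈ s, P i) = ∑ i ∈ s, matDeriv (P i) := by
  ext i j : 2
  simp [matDeriv, Matrix.sum_apply]

/-- This uniqueness principle replaces every expansion of `e^{-At} B e^{At}` below by a comparison
of derivatives and values at `0`. -/
theorem eq_of_matDeriv_eq {P Q : MatPoly N} (h : matDeriv P = matDeriv Q)
    (h0 : (evalRingHom 0).mapMatrix P = (evalRingHom 0).mapMatrix Q) : P = Q := by
  refine Matrix.ext fun i j => ?_
  have h1 : derivative (P i j - Q i j) = 0 := by
    have := congrFun (congrFun h i) j
    simp only [matDeriv, map_apply] at this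
    rw [derivative_sub, this, sub_self]
  have h2 : (P i j - Q i j).eval 0 = 0 := by
    have := congrFun (congrFun h0 i) j
    simp only [RingHom.mapMatrix_apply, map_apply, coe_evalRingHom] at this
    rw [eval_sub, this, sub_self]
  have h3 := eq_C_of_derivative_eq_zero h1
  rw [h3, eval_C] at h2
  rw [h2, C_0] at h3
  exact sub_eq_zero.1 h3

theorem applyRight_two (P : MatPoly N) (D : DiffOp 2 N) :
    applyRight P D = P * D 0 + matDeriv P * D 1 + matDeriv (matDeriv P) * D 2 := by
  rw [applyRight, Fin.sum_univ_three]
  simp only [matDeriv, Matrix.map_map]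
  congr 2

theorem applyRight_add {k : ℕ} (P : MatPoly N) (D E : DiffOp k N) :
    applyRight P (D + E) = applyRight P D + applyRight P E := by
  simp [applyRight, mul_add, Finset.sum_add_distrib]

theorem applyRight_smul {k : ℕ} (P : MatPoly N) (c : ℂ) (D : DiffOp k N) :
    applyRight P (c • D) = c • applyRight P D := by
  simp [applyRight, Finset.smul_sum]

end Calculus

/-! ### Conjugation by the polynomial exponential -/

section Exponential

variable {N : ℕ}

/-- The polynomial `e^{At}` for a matrix `A` with `A ^ N = 0`. -/
noncomputable def expPoly (A : Matrix (Fin N) (Fin N) ℂ) : MatPoly N :=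
  ∑ n ∈ Finset.range N, monomial n ((n.factorial : ℂ)⁻¹) • const (A ^ n)

variable {A : Matrix (Fin N) (Fin N) ℂ}

theorem commute_const_expPoly : Commute (const A) (expPoly A) := by
  refine Commute.sum_right _ _ _ fun n _ => Commute.smul_right ?_ _
  rw [const_pow]
  exact Commute.self_pow _ n

theorem matDeriv_expPoly (hA : A ^ N = 0) : matDeriv (expPoly A) = const A * expPoly A := by
  rcases N with _ | N
  · exact Subsingleton.elim _ _
  · rw [expPoly, matDeriv_sum, Finset.sum_range_succ', Finset.mul_sum, Finset.sum_range_succ]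
    -- One more factor `A` kills the top summand, so the truncated series still solves `T' = AT`.
    have hlast : const A * (monomial N ((N.factorial : ℂ)⁻¹) • const (A ^ N)) = 0 := by
      rw [mul_smul_comm, ← const_mul, ← pow_succ', hA, const_zero, smul_zero]
    rw [hlast, add_zero, matDeriv_smul_const]
    simp only [monomial_zero_left, derivative_C, zero_smul, add_zero]
    refine Finset.sum_congr rfl fun n _ => ?_
    rw [matDeriv_smul_const, mul_smul_comm, ← const_mul, ← pow_succ', derivative_monomial]
    congr 2
    have : (n.factorial : ℂ) ≠ 0 := by exact_mod_cast n.factorial_ne_zero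
    have : (n : ℂ) + 1 ≠ 0 := by exact_mod_cast n.succ_ne_zero
    rw [Nat.factorial_succ]
    push_cast
    field_simp

theorem mapMatrix_eval_zero_const (B : Matrix (Fin N) (Fin N) ℂ) :
    (evalRingHom 0).mapMatrix (const B) = B := by
  ext i j
  simp [const]

theorem mapMatrix_eval_zero_X_smul (p : ℂ[X]) (P : MatPoly N) :
    (evalRingHom 0).mapMatrix ((X * p) • P) = 0 := by
  ext i j
  simp

theorem mapMatrix_eval_zero_expPoly (A : Matrix (Fin N) (Fin N) ℂ) :
    (evalRingHom 0).mapMatrix (expPoly A) = 1 := by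
  rcases N with _ | N
  · exact Subsingleton.elim _ _
  · rw [expPoly, Finset.sum_range_succ', map_add, map_sum, Finset.sum_eq_zero fun n _ => ?_]
    · simp only [monomial_zero_left, pow_zero, const_one]
      ext i j
      by_cases h : i = j <;> simp [h, one_apply]
    · rw [show monomial (n + 1) (((n + 1).factorial : ℂ)⁻¹)
        = X * monomial n (((n + 1).factorial : ℂ)⁻¹) by rw [X_mul_monomial]]
      exact mapMatrix_eval_zero_X_smul _ _

theorem matDeriv_conj_expPoly (hA : A ^ N = 0) (B : Matrix (Fin N) (Fin N) ℂ) :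
    matDeriv (expPoly (-A) * const B * expPoly A)
      = expPoly (-A) * const (B * A - A * B) * expPoly A := by
  have hA' : (-A) ^ N = 0 := by rw [neg_pow, hA, mul_zero]
  have h : matDeriv (expPoly (-A)) = expPoly (-A) * const (-A) := by
    rw [matDeriv_expPoly hA', commute_const_expPoly.eq]
  rw [matDeriv_mul, matDeriv_mul, matDeriv_const, h, matDeriv_expPoly hA, const_sub, const_mul,
    const_mul,
    const_neg]
  noncomm_ring

theorem expPoly_neg_mul_expPoly (hA : A ^ N = 0) : expPoly (-A) * expPoly A = 1 := by
  refine eq_of_matDeriv_eq ?_ ?_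
  · have := matDeriv_conj_expPoly hA 1
    rw [const_one, mul_one] at this
    rw [this, ← const_one, matDeriv_const]
    simp [const_zero]
  · rw [map_mul, map_one, mapMatrix_eval_zero_expPoly, mapMatrix_eval_zero_expPoly, mul_one]

theorem expPoly_mul_expPoly_neg (hA : A ^ N = 0) : expPoly A * expPoly (-A) = 1 :=
  mul_eq_one_comm.1 (expPoly_neg_mul_expPoly hA)

/-- Conjugation `P ↦ e^{-At} P e^{At}` by the polynomial `e^{At}`. -/
noncomputable def conjExp (hA : A ^ N = 0) : MatPoly N →ₐ[ℂ[X]] MatPoly N where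
  toFun P := expPoly (-A) * P * expPoly A
  map_one' := by rw [mul_one, expPoly_neg_mul_expPoly hA]
  map_mul' P Q := by
    have := expPoly_mul_expPoly_neg hA
    calc expPoly (-A) * (P * Q) * expPoly A
        = expPoly (-A) * P * 1 * Q * expPoly A := by noncomm_ring
      _ = _ := by rw [← this]; noncomm_ring
  map_zero' := by simp
  map_add' P Q := by noncomm_ring
  commutes' p := by
    rw [Algebra.algebraMap_eq_smul_one]
    simp [expPoly_neg_mul_expPoly hA]

theorem expPoly_mul_conjExp (hA : A ^ N = 0) (P : MatPoly N) :
    expPoly A * conjExp hA P = P * expPoly A := by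
  change expPoly A * (expPoly (-A) * P * expPoly A) = _
  rw [← mul_assoc, ← mul_assoc, expPoly_mul_expPoly_neg hA, one_mul]

theorem matDeriv_conjExp_const (hA : A ^ N = 0) (B : Matrix (Fin N) (Fin N) ℂ) :
    matDeriv (conjExp hA (const B)) = conjExp hA (const (B * A - A * B)) :=
  matDeriv_conj_expPoly hA B

theorem mapMatrix_eval_zero_conjExp_const (hA : A ^ N = 0) (B : Matrix (Fin N) (Fin N) ℂ) :
    (evalRingHom 0).mapMatrix (conjExp hA (const B)) = B := by
  change (evalRingHom 0).mapMatrix (expPoly (-A) * const B * expPoly A) = B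
  rw [map_mul, map_mul, mapMatrix_eval_zero_expPoly, mapMatrix_eval_zero_expPoly,
    mapMatrix_eval_zero_const, one_mul, mul_one]

theorem conjExp_const_self (hA : A ^ N = 0) : conjExp hA (const A) = const A := by
  refine eq_of_matDeriv_eq ?_ ?_
  · rw [matDeriv_conjExp_const, matDeriv_const, sub_self, const_zero, map_zero]
  · rw [mapMatrix_eval_zero_conjExp_const, mapMatrix_eval_zero_const]

/-- The derivative is the conjugate of `[J, A] = A`, which is constant. -/
theorem conjExp_const_of_lie_eq (hA : A ^ N = 0) {J : Matrix (Fin N) (Fin N) ℂ}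
    (hJ : J * A = A * J + A) : conjExp hA (const J) = const J + (X : ℂ[X]) • const A := by
  refine eq_of_matDeriv_eq ?_ ?_
  · rw [matDeriv_conjExp_const, hJ, add_sub_cancel_left, conjExp_const_self, matDeriv_add,
      matDeriv_const,
      matDeriv_smul_const, derivative_X, one_smul, zero_add]
  · have := mapMatrix_eval_zero_X_smul 1 (const A)
    rw [mul_one] at this
    rw [mapMatrix_eval_zero_conjExp_const, map_add, mapMatrix_eval_zero_const, this, add_zero]

/-- The derivative is the conjugate of `[Y, A] = n - 2J`, namely `n - 2(J + tA)`; integration gives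
the quadratic. -/
theorem conjExp_const_of_lie_eq_neg (hA : A ^ N = 0) {J Y : Matrix (Fin N) (Fin N) ℂ} {n : ℂ}
    (hJ : J * A = A * J + A) (hY : Y * A = A * Y - (2 : ℂ) • J + n • 1) :
    conjExp hA (const Y) = const Y - (X : ℂ[X]) • const ((2 : ℂ) • J - n • 1)
      - (X : ℂ[X]) ^ 2 • const A := by
  refine eq_of_matDeriv_eq ?_ ?_
  · rw [matDeriv_conjExp_const, hY, show A * Y - (2 : ℂ) • J + n • (1 : Matrix (Fin N) (Fin N) ℂ)
      - A * Y = n • 1 - (2 : ℂ) • J by abel, matDeriv_sub, matDeriv_sub, matDeriv_const,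
      matDeriv_smul_const,
      matDeriv_smul_const, const_sub, const_sub, const_smul, const_smul, const_one, map_sub,
      map_smul,
      map_smul, map_one, conjExp_const_of_lie_eq hA hJ, derivative_X, derivative_X_pow]
    have h2 : (C 2 : ℂ[X]) = 2 := rfl
    simp only [h2, Nat.cast_ofNat, Nat.reduceSub, pow_one]
    module
  · have h1 := mapMatrix_eval_zero_X_smul 1 (const ((2 : ℂ) • J - n • 1))
    have h2 := mapMatrix_eval_zero_X_smul X (const A)
    rw [mul_one] at h1
    rw [← sq] at h2
    rw [mapMatrix_eval_zero_conjExp_const, map_sub, map_sub, mapMatrix_eval_zero_const, h1, h2,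
      sub_zero, sub_zero]

/-- An operator `D` is conjugated by `e^{At}` into the operator `E`. -/
theorem applyRight_mul_expPoly (hA : A ^ N = 0) {D E : DiffOp 2 N}
    (h2 : conjExp hA (D 2) = E 2)
    (h1 : conjExp hA (D 1) = (2 : ℂ[X]) • (const A * E 2) + E 1)
    (h0 : conjExp hA (D 0) = const A * const A * E 2 + const A * E 1 + E 0) (P : MatPoly N) :
    applyRight P D * expPoly A = applyRight (P * expPoly A) E := by
  -- As `T' = TA`, differentiating `PT` puts powers of `A` to the right of `T`; the hypotheses match
  -- the coefficients of `P''T`, `P'T` and `PT`.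
  have hd : matDeriv (P * expPoly A) = matDeriv P * expPoly A + P * expPoly A * const A := by
    rw [matDeriv_mul, matDeriv_expPoly hA, commute_const_expPoly.eq, mul_assoc]
  have hdd : matDeriv (matDeriv (P * expPoly A)) = matDeriv (matDeriv P) * expPoly A
      + matDeriv P * expPoly A * const A + matDeriv P * expPoly A * const A
      + P * expPoly A * const A * const A := by
    rw [hd, matDeriv_add, matDeriv_mul, matDeriv_mul _ (const A), matDeriv_const, hd,
      matDeriv_expPoly hA,
      commute_const_expPoly.eq]
    noncomm_ring
  rw [applyRight_two, applyRight_two, hdd, hd, add_mul, add_mul, mul_assoc, mul_assoc, mul_assoc,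
    ← expPoly_mul_conjExp hA, ← expPoly_mul_conjExp hA, ← expPoly_mul_conjExp hA, h2, h1, h0,
    two_smul]
  noncomm_ring

end Exponential

/-! ### Noncommutative identities behind the conjugated operators -/

section Identities

variable {K R : Type*} [CommRing K] [Ring R] [Algebra K R] {a j y : R} {x α c n : K}

/-- Condition `h0` of `applyRight_mul_expPoly` for `D₁`, with `x = t`. -/
theorem conj_identity_one (hj : j * a = a * j + a) :
    (j + x • a + α • 1) * a - (j + x • a)
      = a * a * (x • 1) + a * ((α + 1) • 1 + j - x • 1) + -j := by
  simp only [mul_add, add_mul, mul_sub, smul_mul_assoc, mul_smul_comm, one_mul, mul_one, hj]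
  module

/-- Condition `h1` for `D₂`, with `Y^*` written as `A(J + c)`. All terms in `t²` cancel. -/
theorem conj_identity_two (hj : j * a = a * j + a) (hy : y * a = a * y - (2 : K) • j + n • 1) :
    ((1 + α) • 1 + (j + x • a)) * (j + x • a) + (y - x • ((2 : K) • j - n • 1) - x ^ 2 • a)
      - x • ((j + x • a) + (α + 2) • a + a * (j + x • a + c • 1)
        - a * (y - x • ((2 : K) • j - n • 1) - x ^ 2 • a)
        + (y - x • ((2 : K) • j - n • 1) - x ^ 2 • a) * a)
      = (2 : K) • (a * (x • j))
        + ((((1 + α) • 1 + j) * j + y) - x • j - x • (a * (j + c • 1))) := by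
  simp only [mul_add, add_mul, sub_mul, mul_sub, smul_mul_assoc, mul_smul_comm, one_mul, mul_one,
    hj, hy]
  module

/-- Condition `h0` for `D₂`. The product `A(J + c)(J + α + 1)` is `(J + α)A(J + c)`, that is
`diag(β) Y^*`, with `J` moved to the right. -/
theorem conj_identity_three (hj : j * a = a * j + a) :
    c • ((j + x • a) - (α • 1 + (j + x • a)) * a)
      = a * a * (x • j) + a * ((((1 + α) • 1 + j) * j + y) - x • j - x • (a * (j + c • 1)))
        + (x • (a * (j + c • 1)) - a * (j + c • 1) * (j + (α + 1) • 1) + (c • j - a * y)) := by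
  simp only [mul_add, add_mul, mul_sub, smul_mul_assoc, mul_smul_comm, one_mul, mul_one,
    hj, mul_assoc]
  module

end Identities

/-! ### Symmetric operators for a diagonal Laguerre weight -/

section DiagonalForm

variable {N : ℕ} {β : Fin N → ℝ}

/-- The bilinear form `∫ R(t) diag(t^{β_m} e^{-t}) S(t)ᵀ dt`. -/
noncomputable def diagForm (β : Fin N → ℝ) (R S : MatPoly N) : Matrix (Fin N) (Fin N) ℂ :=
  Matrix.of fun i j => ∑ m, laguerre (β m) (R i m * S j m)

theorem diagForm_apply (R S : MatPoly N) (i j : Fin N) :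
    diagForm β R S i j = ∑ m, laguerre (β m) (R i m * S j m) := rfl

theorem diagForm_add_left (R R' S : MatPoly N) :
    diagForm β (R + R') S = diagForm β R S + diagForm β R' S := by
  ext i j
  simp [diagForm_apply, add_mul, Finset.sum_add_distrib]

theorem diagForm_transpose (R S : MatPoly N) : (diagForm β R S)ᵀ = diagForm β S R := by
  ext i j
  simp [diagForm_apply, mul_comm]

theorem diagForm_add_right (R S S' : MatPoly N) :
    diagForm β R (S + S') = diagForm β R S + diagForm β R S' := by
  rw [← diagForm_transpose, diagForm_add_left, transpose_add, diagForm_transpose,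
    diagForm_transpose]

/-- Sturm–Liouville form: both sides equal `-∫ r' s' t^{b+1} e^{-t} dt`. -/
theorem laguerre_operator_symm {b : ℝ} (hb : -1 < b) (r s : ℂ[X]) :
    laguerre b ((X * derivative (derivative r) + (C ((b : ℂ) + 1) - X) * derivative r) * s)
      =
          laguerre b (r * (X * derivative (derivative s) + (C ((b : ℂ) + 1) - X) * derivative s)) := by
  have key : ∀ p q : ℂ[X],
      laguerre b ((X * derivative (derivative p) + (C ((b : ℂ) + 1) - X) * derivative p) * q)
        = -laguerre b (X * (derivative p * derivative q)) := by
    intro p q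
    have h := laguerre_X_mul_derivative hb (derivative p * q)
    rw [derivative_mul, mul_add, map_add] at h
    rw [show (X * derivative (derivative p) + (C ((b : ℂ) + 1) - X) * derivative p) * q
      = X * (derivative (derivative p) * q) + ((b : ℂ) + 1) • (derivative p * q)
        - X * (derivative p * q) by rw [smul_eq_C_mul]; ring, map_sub, map_add, map_smul,
        smul_eq_mul]
    linear_combination h
  rw [key, mul_comm r, key, mul_comm (derivative r)]

/-- Integration by parts gives the adjoint of `∂` between the weights of parameters `b` and `b + 1`;
this is how `Y` couples neighbouring components. -/
theorem laguerre_derivative_mul {b : ℝ} (hb : -1 < b) (r s : ℂ[X]) :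
    laguerre (b + 1) (derivative r * s)
      = laguerre b (r * (X * s - s * C ((b : ℂ) + 1) - X * derivative s)) := by
  have h := laguerre_X_mul_derivative hb (r * s)
  rw [derivative_mul, mul_add, map_add] at h
  rw [← laguerre_X_mul, show r * (X * s - s * C ((b : ℂ) + 1) - X * derivative s)
    = X * (r * s) - ((b : ℂ) + 1) • (r * s) - X * (r * derivative s) by rw [smul_eq_C_mul]; ring,
    map_sub, map_sub, map_smul, smul_eq_mul]
  linear_combination h

/-- An operator symmetric with respect to `diagForm β`. -/
def IsDiagSymmetric (β : Fin N → ℝ) (E : DiffOp 2 N) : Prop :=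
  ∀ R S : MatPoly N, diagForm β (applyRight R E) S = diagForm β R (applyRight S E)

theorem IsDiagSymmetric.add {E E' : DiffOp 2 N} (h : IsDiagSymmetric β E)
    (h' : IsDiagSymmetric β E') : IsDiagSymmetric β (E + E') := fun R S => by
  rw [applyRight_add, applyRight_add, diagForm_add_left, diagForm_add_right, h, h']

/-- The diagonal operator with entries `e_m (t ∂² + (β_m + 1 - t) ∂) + d_m`. -/
noncomputable def diagOp (β : Fin N → ℝ) (e d : Fin N → ℂ) : DiffOp 2 N :=
  ![const (diagonal d), const (diagonal fun m => ((β m : ℂ) + 1) * e m)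
      - (X : ℂ[X]) • const (diagonal e), (X : ℂ[X]) • const (diagonal e)]

theorem applyRight_diagOp_apply (R : MatPoly N) (e d : Fin N → ℂ) (i m : Fin N) :
    applyRight R (diagOp β e d) i m = d m • R i m
      + e m • (X * derivative (derivative (R i m))
        + (C ((β m : ℂ) + 1) - X) * derivative (R i m)) := by
  rw [applyRight_two]
  simp only [diagOp, const_diagonal, cons_val_zero, cons_val_one, cons_val, Matrix.add_apply,
    mul_sub,
    mul_smul_comm, Matrix.sub_apply, Matrix.smul_apply, mul_diagonal, matDeriv, map_apply,
    smul_eq_C_mul,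
    smul_eq_mul, C_mul]
  ring

theorem isDiagSymmetric_diagOp (hβ : ∀ m, -1 < β m) (e d : Fin N → ℂ) :
    IsDiagSymmetric β (diagOp β e d) := fun R S => by
  ext i j
  simp only [diagForm_apply, applyRight_diagOp_apply]
  refine Finset.sum_congr rfl fun m _ => ?_
  rw [add_mul, mul_add, LinearMap.map_add, LinearMap.map_add, smul_mul_assoc, smul_mul_assoc,
    mul_smul_comm,
    mul_smul_comm, map_smul, map_smul, laguerre_operator_symm (hβ m), map_smul]

/-- The part of first order formed by an off-diagonal matrix `Y` and its formal adjoint. -/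
noncomputable def shiftOp (β : Fin N → ℝ) (Y : Matrix (Fin N) (Fin N) ℂ) : DiffOp 2 N :=
  ![(X : ℂ[X]) • const Yᵀ - const (diagonal (fun m => (β m : ℂ)) * Yᵀ),
    const Y - (X : ℂ[X]) • const Yᵀ, 0]

theorem applyRight_shiftOp (R : MatPoly N) (Y : Matrix (Fin N) (Fin N) ℂ) :
    applyRight R (shiftOp β Y) = matDeriv R * const Y
      + ((X : ℂ[X]) • R - R * const (diagonal fun m => (β m : ℂ)) - (X : ℂ[X]) • matDeriv R)
        * const Yᵀ := by
  rw [applyRight_two]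
  simp only [shiftOp, cons_val_zero, cons_val_one, cons_val, mul_zero, add_zero, const_mul, mul_sub,
    sub_mul, mul_smul_comm, smul_mul_assoc, mul_assoc]
  abel

theorem diagForm_matDeriv_mul_const (hβ : ∀ m, -1 < β m) {Y : Matrix (Fin N) (Fin N) ℂ}
    (hY : ∀ l m, Y l m ≠ 0 → β m = β l + 1) (R S : MatPoly N) :
    diagForm β (matDeriv R * const Y) S = diagForm β R
      (((X : ℂ[X]) • S - S * const (diagonal fun m => (β m : ℂ)) - (X : ℂ[X]) • matDeriv S)
        * const Yᵀ) := by
  ext i j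
  simp only [diagForm_apply, mul_apply, Finset.sum_mul, Finset.mul_sum, map_sum]
  rw [Finset.sum_comm]
  refine Finset.sum_congr rfl fun l _ => Finset.sum_congr rfl fun m _ => ?_
  simp only [const_diagonal, Matrix.sub_apply, Matrix.smul_apply, mul_diagonal, matDeriv,
    map_apply, smul_eq_mul]
  simp only [const, map_apply, transpose_apply]
  rcases eq_or_ne (Y l m) 0 with h | h
  · simp [h]
  -- The constant `β l + 1` produced by the parts formula is `β m`, whence the right multiplication
  -- of `S` by `diag(β)`.
  · have hm : (β m : ℂ) = β l + 1 := by rw [hY l m h]; push_cast; rfl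
    rw [mul_comm _ (C (Y l m)), ← mul_assoc (R i l), mul_comm _ (C (Y l m)), mul_assoc,
      ← smul_eq_C_mul, ← smul_eq_C_mul, map_smul, map_smul, hm, hY l m h,
      laguerre_derivative_mul (hβ l)]

/-- The operator is `∂Y` plus its adjoint, and the bilinear form is symmetric up to transposition.
-/
theorem isDiagSymmetric_shiftOp (hβ : ∀ m, -1 < β m) {Y : Matrix (Fin N) (Fin N) ℂ}
    (hY : ∀ l m, Y l m ≠ 0 → β m = β l + 1) : IsDiagSymmetric β (shiftOp β Y) := fun R S => by
  rw [applyRight_shiftOp, applyRight_shiftOp, diagForm_add_left, diagForm_add_right,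
    diagForm_matDeriv_mul_const hβ hY R S, add_comm, ← diagForm_transpose (matDeriv S * _) R,
    diagForm_matDeriv_mul_const hβ hY S R, diagForm_transpose]

/-- Real coefficients let the conjugation of the second argument pass through the operator, so the
bilinear `diagForm` suffices for a sesquilinear form. -/
theorem mapMatrix_conjPoly_applyRight {E : DiffOp 2 N}
    (hE : ∀ k, conjPoly.mapMatrix (E k) = E k) (Q : MatPoly N) :
    conjPoly.mapMatrix (applyRight Q E) = applyRight (conjPoly.mapMatrix Q) E := by
  have hd : ∀ Q : MatPoly N, conjPoly.mapMatrix (matDeriv Q) = matDeriv (conjPoly.mapMatrix Q) := by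
    intro Q
    refine Matrix.ext fun i j => ?_
    simp [matDeriv, conjPoly, derivative_map]
  simp only [applyRight_two, map_add, map_mul, hE, hd]

end DiagonalForm

/-! ### Relations between `J`, `A`, `Y` and factorization of the density -/

section Example

variable {N : ℕ}

theorem matA_pow_apply_of_ne (ν : ℕ → ℝ) (n : ℕ) (i j : Fin N) (h : (j : ℕ) ≠ i + n) :
    (matA N ν ^ n) i j = 0 := by
  induction n generalizing j with
  | zero =>
    rw [pow_zero, one_apply_ne]
    rintro rfl
    exact h rfl
  | succ n ih =>
    rw [pow_succ, mul_apply]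
    refine Finset.sum_eq_zero fun k _ => ?_
    by_cases hk : (k : ℕ) = i + n
    · have : ¬ (j : ℕ) = k + 1 := by omega
      simp [matA, this]
    · rw [ih k hk, zero_mul]

theorem matA_pow_card (N : ℕ) (ν : ℕ → ℝ) : matA N ν ^ N = 0 := by
  ext i j
  exact matA_pow_apply_of_ne ν N i j (by omega)

theorem matJ_mul_matA (N : ℕ) (ν : ℕ → ℝ) :
    matJ N * matA N ν = matA N ν * matJ N + matA N ν := by
  ext i j
  simp only [matJ, diagonal_mul, mul_diagonal, Matrix.add_apply, matA, of_apply]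
  split_ifs with h
  · rw [h]
    push_cast
    ring
  · simp

theorem matA_mul_matY (ν : ℕ → ℝ) (hν : ∀ i, 1 ≤ i → i ≤ N - 1 → ν i ≠ 0) :
    matA N ν * matY N ν = diagonal fun i : Fin N => ((i : ℂ) + 1) * ((N : ℂ) - ((i : ℂ) + 1)) := by
  ext i j
  rw [mul_apply, diagonal_apply]
  by_cases hi : (i : ℕ) + 1 < N
  · rw [Finset.sum_eq_single ⟨i + 1, hi⟩]
    · have h0 : (ν (i + 1) : ℂ) ≠ 0 := by exact_mod_cast hν _ (by omega) (by omega)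
      by_cases h : i = j
      · subst h
        simp only [matA, matY, of_apply, if_true]
        field_simp
      · have : ¬ (i : ℕ) = j := fun h' => h (Fin.ext h')
        simp [matA, matY, h, this]
    · intro k _ hk
      have : ¬ (k : ℕ) = i + 1 := fun h' => hk (Fin.ext h')
      simp [matA, this]
    · simp
  -- The last row of `A` is zero, in agreement with `i(N - i) = 0` at `i = N`.
  · rw [Finset.sum_eq_zero]
    · have : (N : ℂ) = i + 1 := by
        have := i.2
        exact_mod_cast (by omega : N = i + 1)
      simp [this]
    · intro k _
      have : ¬ (k : ℕ) = i + 1 := by omega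
      simp [matA, this]

theorem matY_mul_matA (ν : ℕ → ℝ) (hν : ∀ i, 1 ≤ i → i ≤ N - 1 → ν i ≠ 0) :
    matY N ν * matA N ν = diagonal fun i : Fin N => (i : ℂ) * ((N : ℂ) - i) := by
  ext i j
  rw [mul_apply, diagonal_apply]
  by_cases hi : 1 ≤ (i : ℕ)
  · rw [Finset.sum_eq_single ⟨i - 1, by omega⟩]
    · have h0 : (ν i : ℂ) ≠ 0 := by exact_mod_cast hν i (by omega) (by omega)
      have h1 : (i : ℕ) - 1 + 1 = i := by omega
      have h2 : (((i : ℕ) - 1 : ℕ) : ℂ) + 1 = i := by exact_mod_cast h1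
      by_cases h : i = j
      · subst h
        simp only [matA, matY, of_apply, h1, h2, if_true]
        field_simp
      · have : ¬ (j : ℕ) = i := fun h' => h (Fin.ext h'.symm)
        simp [matA, h1, h, this]
    · intro k _ hk
      have : ¬ (i : ℕ) = k + 1 := fun h' => hk (Fin.ext (by simp; omega))
      simp [matY, this]
    · simp
  · rw [Finset.sum_eq_zero]
    · have : (i : ℕ) = 0 := by omega
      simp [this]
    · intro k _
      have : ¬ (i : ℕ) = k + 1 := by omega
      simp [matY, this]

/-- The `ν_i` cancel in `AY` and `YA`, whose diagonal entries are consecutive values of `i(N - i)`;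
their difference is linear in `i`. -/
theorem matY_mul_matA_eq (ν : ℕ → ℝ) (hν : ∀ i, 1 ≤ i → i ≤ N - 1 → ν i ≠ 0) :
    matY N ν * matA N ν
      = matA N ν * matY N ν - (2 : ℂ) • matJ N + ((N : ℂ) - 1) • 1 := by
  rw [matY_mul_matA ν hν, matA_mul_matY ν hν, matJ, smul_one_eq_diagonal, ← diagonal_smul,
    diagonal_sub, diagonal_add]
  congr 1
  funext i
  simp only [Pi.smul_apply, smul_eq_mul]
  ring

theorem conjTranspose_matY_apply (ν : ℕ → ℝ) (i j : Fin N) :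
    (matY N ν)ᴴ i j = if (j : ℕ) = i + 1 then
      ((i : ℂ) + 1) * ((N : ℂ) - ((i : ℂ) + 1)) / (ν (i + 1) : ℂ) else 0 := by
  rw [conjTranspose_apply, matY, of_apply]
  split_ifs <;> simp

theorem transpose_matY_eq (ν : ℕ → ℝ) : (matY N ν)ᵀ = (matY N ν)ᴴ := by
  ext i j
  rw [conjTranspose_matY_apply, transpose_apply, matY, of_apply]

/-- Entrywise this is `i(N-i)/ν_i = ν_i(N-i-1+c)`, the condition on the `ν_i` after clearing
denominators. -/
theorem conjTranspose_matY_eq (ν : ℕ → ℝ) (hν : ∀ i, 1 ≤ i → i ≤ N - 1 → ν i ≠ 0)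
    (h : ∀ i : ℕ, 1 ≤ i → i ≤ N - 2 → (i : ℝ) * ((N : ℝ) - i) * ν (N - 1) ^ 2 =
      ((N : ℝ) - 1) * ν i ^ 2 + ((N : ℝ) - i - 1) * ν i ^ 2 * ν (N - 1) ^ 2) :
    (matY N ν)ᴴ = matA N ν * (matJ N + (((N : ℂ) - 1) / (ν (N - 1) : ℂ) ^ 2) • 1) := by
  ext i j
  rw [conjTranspose_matY_apply, matJ, smul_one_eq_diagonal, diagonal_add, mul_diagonal, matA,
    of_apply]
  split_ifs with hj
  · have hlt := j.2
    have hN : ν (N - 1) ≠ 0 := hν _ (by omega) le_rfl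
    have hi : ν (i + 1) ≠ 0 := hν _ (by omega) (by omega)
    have key : ((i + 1 : ℕ) : ℝ) * ((N : ℝ) - (i + 1 : ℕ)) * ν (N - 1) ^ 2 =
        ((N : ℝ) - 1) * ν (i + 1) ^ 2
          + ((N : ℝ) - (i + 1 : ℕ) - 1) * ν (i + 1) ^ 2 * ν (N - 1) ^ 2 := by
      rcases Nat.lt_or_ge (i + 1) (N - 1) with h1 | h1
      · exact h _ (by omega) (by omega)
      -- The hypothesis stops at `N - 2`; at `N - 1` the relation is automatic.
      · have h2 : (i : ℕ) + 1 = N - 1 := by omega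
        have h3 : (N : ℝ) = (i : ℕ) + 1 + 1 := by exact_mod_cast (by omega : N = (i : ℕ) + 1 + 1)
        rw [h2, ← h2, h3]
        push_cast
        ring
    have key' : ((i : ℂ) + 1) * ((N : ℂ) - ((i : ℂ) + 1)) * (ν (N - 1) : ℂ) ^ 2 =
        ((N : ℂ) - 1) * (ν (i + 1) : ℂ) ^ 2
          + ((N : ℂ) - ((i : ℂ) + 1) - 1) * (ν (i + 1) : ℂ) ^ 2 * (ν (N - 1) : ℂ) ^ 2 := by
      exact_mod_cast congrArg ((↑) : ℝ → ℂ) key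
    have hN' : (ν (N - 1) : ℂ) ≠ 0 := by exact_mod_cast hN
    have hi' : (ν (i + 1) : ℂ) ≠ 0 := by exact_mod_cast hi
    rw [hj]
    push_cast
    field_simp
    linear_combination key'
  · simp

/-- The exponents `α + N - i` of the diagonalized weight. -/
noncomputable def exponent (N : ℕ) (α : ℝ) (m : Fin N) : ℝ := α + (N - ((m : ℕ) + 1))

theorem neg_one_lt_exponent {α : ℝ} (hα : -1 < α) (m : Fin N) : -1 < exponent N α m := by
  have : ((m : ℕ) + 1 : ℝ) ≤ N := by exact_mod_cast m.2
  rw [exponent]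
  linarith

theorem exp_smul_eq_map_expPoly {A : Matrix (Fin N) (Fin N) ℂ} (hA : A ^ N = 0) (t : ℂ) :
    NormedSpace.exp (t • A) = (expPoly A).map (eval t) := by
  rw [NormedSpace.exp_eq_tsum ℂ]
  beta_reduce
  rw [tsum_eq_sum (s := Finset.range N)]
  · ext i j
    rw [Matrix.sum_apply, map_apply, expPoly, Matrix.sum_apply, eval_finsetSum]
    refine Finset.sum_congr rfl fun n _ => ?_
    simp only [_root_.smul_pow, Matrix.smul_apply, const, map_apply, smul_eq_mul, eval_mul,
      eval_monomial,
      eval_C]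
    ring
  · intro n hn
    have : A ^ n = 0 := pow_eq_zero_of_le (by simpa using hn) hA
    rw [_root_.smul_pow, this, smul_zero, smul_zero]

theorem matPow_half_matJ_mul (t : ℝ) :
    matPow t ((1 / 2 : ℂ) • matJ N) * matPow t ((1 / 2 : ℂ) • (matJ N)ᴴ)
      = diagonal fun m : Fin N => ((Real.exp (Real.log t * (N - ((m : ℕ) + 1))) : ℝ) : ℂ) := by
  have hJ : (matJ N)ᴴ = matJ N := by
    rw [matJ, diagonal_conjTranspose]
    congr 1
    funext m
    simp
  rw [hJ, matPow, matJ, ← diagonal_smul, ← diagonal_smul, exp_diagonal, diagonal_mul_diagonal]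
  congr 1
  funext m
  rw [Pi.coe_exp]
  simp only [Pi.smul_apply, smul_eq_mul, ← Complex.exp_eq_exp_ℂ, ← Complex.exp_add]
  push_cast
  congr 1
  ring

theorem density_apply {α : ℝ} (ν : ℕ → ℝ) {t : ℝ} (ht : 0 < t) (i j : Fin N) :
    density N α ν t i j = ∑ m, (expPoly (matA N ν) i m
      * conjPoly (expPoly (matA N ν) j m)).eval (t : ℂ) * laguerreDensity (exponent N α m) t := by
  have hE := exp_smul_eq_map_expPoly (matA_pow_card N ν) (t : ℂ)
  have hE' : NormedSpace.exp ((t : ℂ) • (matA N ν)ᴴ) =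
      ((expPoly (matA N ν)).map (eval (t : ℂ)))ᴴ := by
    rw [← hE, ← exp_conjTranspose, conjTranspose_smul]
    simp
  rw [density, mul_assoc (NormedSpace.exp _), matPow_half_matJ_mul, hE, hE', Matrix.smul_apply,
    mul_apply, Finset.smul_sum]
  refine Finset.sum_congr rfl fun m _ => ?_
  rw [mul_diagonal, conjTranspose_apply, map_apply, map_apply, eval_mul, eval_conjPoly,
    laguerreDensity, exponent, Real.rpow_add ht, Real.rpow_def_of_pos ht (_ - _)]
  push_cast
  simp only [smul_eq_mul]
  ring

end Example

/-! ### Reduction of the matrix weight to the diagonal form -/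

section Form

variable {N : ℕ} {α : ℝ}

theorem integrableOn_eval_mul_density (hα : -1 < α) (ν : ℕ → ℝ) (p : ℂ[X]) (i j : Fin N) :
    IntegrableOn (fun t : ℝ => p.eval (t : ℂ) * density N α ν t i j) (Set.Ioi 0) := by
  have h : IntegrableOn (fun t : ℝ => ∑ m, (p * (expPoly (matA N ν) i m
      * conjPoly (expPoly (matA N ν) j m))).eval (t : ℂ) * laguerreDensity (exponent N α m) t)
      (Set.Ioi 0) := integrable_finsetSum _ fun m _ =>
    integrableOn_eval_mul_laguerreDensity (neg_one_lt_exponent hα m) _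
  refine h.congr_fun (fun t ht => ?_) measurableSet_Ioi
  simp only [density_apply ν ht, Finset.mul_sum, eval_mul]
  exact Finset.sum_congr rfl fun m _ => by ring

theorem integrableOn_density (hα : -1 < α) (ν : ℕ → ℝ) (i j : Fin N) :
    IntegrableOn (fun t : ℝ => density N α ν t i j) (Set.Ioi 0) := by
  simpa using! integrableOn_eval_mul_density hα ν 1 i j

theorem integral_eval_mul_density (hα : -1 < α) (ν : ℕ → ℝ) (p : ℂ[X]) (i j : Fin N) :
    ∫ t in Set.Ioi (0 : ℝ), p.eval (t : ℂ) * density N α ν t i j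
      = ∑ m, laguerre (exponent N α m) (p * (expPoly (matA N ν) i m
        * conjPoly (expPoly (matA N ν) j m))) := by
  simp only [fun m => laguerre_eq_integral (neg_one_lt_exponent hα m)]
  rw [← integral_finsetSum _ fun m _ =>
    integrableOn_eval_mul_laguerreDensity (neg_one_lt_exponent hα m) _]
  refine setIntegral_congr_fun measurableSet_Ioi fun t ht => ?_
  simp only [density_apply ν ht, Finset.mul_sum, eval_mul]
  exact Finset.sum_congr rfl fun m _ => by ring

theorem integrable_weight (hα : -1 < α) (ν : ℕ → ℝ) (p : ℂ[X]) (i j : Fin N) :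
    (weight N α ν i j).Integrable fun t : ℝ => p.eval (t : ℂ) := by
  have hd := integrableOn_density hα ν i j
  refine (integrable_withDensityᵥ_iff hd).2 ((integrable_norm_smul_iff hd ?_).2
    (integrableOn_eval_mul_density hα ν p i j))
  exact (p.continuous.comp Complex.continuous_ofReal).aestronglyMeasurable

theorem integral_weight (hα : -1 < α) (ν : ℕ → ℝ) (p : ℂ[X]) (i j : Fin N) :
    (weight N α ν i j).integral (fun t : ℝ => p.eval (t : ℂ)) (ContinuousLinearMap.mul ℝ ℂ)
      = ∑ m, laguerre (exponent N α m) (p * (expPoly (matA N ν) i m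
        * conjPoly (expPoly (matA N ν) j m))) := by
  rw [← integral_eval_mul_density hα]
  exact integral_withDensityᵥ (integrableOn_density hα ν i j) (integrable_weight hα ν p i j)

theorem eval_mul_star_eval (p q : ℂ[X]) :
    (fun t : ℝ => p.eval (t : ℂ) * star (q.eval (t : ℂ)))
      = fun t : ℝ => (p * conjPoly q).eval (t : ℂ) := by
  funext t
  rw [eval_mul, eval_conjPoly]

/-- The outer factors `e^{At}` and `e^{A^*t}` of the density are absorbed into `P` and `Q`. -/
theorem form_weight (hα : -1 < α) (ν : ℕ → ℝ) (P Q : MatPoly N) :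
    form (weight N α ν) P Q = diagForm (exponent N α) (P * expPoly (matA N ν))
      (conjPoly.mapMatrix (Q * expPoly (matA N ν))) := by
  ext i j
  have hR : ∀ m, (P * expPoly (matA N ν)) i m
      * (conjPoly.mapMatrix (Q * expPoly (matA N ν))) j m
      = ∑ k, ∑ l, P i k * conjPoly (Q j l) * (expPoly (matA N ν) k m
        * conjPoly (expPoly (matA N ν) l m)) := fun m => by
    simp only [RingHom.mapMatrix_apply, map_apply, mul_apply, map_mul, Finset.sum_mul_sum]
    exact Finset.sum_congr rfl fun k _ => Finset.sum_congr rfl fun l _ => by ring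
  simp only [form, of_apply, eval_mul_star_eval, integral_weight hα, diagForm_apply, hR, map_sum]
  symm
  rw [Finset.sum_comm]
  refine Finset.sum_congr rfl fun k _ => ?_
  rw [Finset.sum_comm]

theorem isSymmetric_weight (hα : -1 < α) (ν : ℕ → ℝ) {D E : DiffOp 2 N}
    (hDE : ∀ P, applyRight P D * expPoly (matA N ν) = applyRight (P * expPoly (matA N ν)) E)
    (hE : IsDiagSymmetric (exponent N α) E) (hE' : ∀ k, conjPoly.mapMatrix (E k) = E k) :
    IsSymmetric D (weight N α ν) := fun P Q => by
  rw [form_weight hα, form_weight hα, hDE, hDE, mapMatrix_conjPoly_applyRight hE', hE]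

end Form

/-! ### Symmetry of `D₁` and `D₂` -/

section Symmetry

variable {N : ℕ} {α : ℝ}

theorem mapMatrix_conjPoly_const {B : Matrix (Fin N) (Fin N) ℂ} (hB : ∀ i j, star (B i j) = B i j) :
    conjPoly.mapMatrix (const B) = const B := by
  refine Matrix.ext fun i j => ?_
  have := hB i j
  simp only [Complex.star_def] at this
  simp [const, conjPoly, this]

theorem mapMatrix_conjPoly_X_smul (P : MatPoly N) :
    conjPoly.mapMatrix ((X : ℂ[X]) • P) = (X : ℂ[X]) • conjPoly.mapMatrix P := by
  refine Matrix.ext fun i j => ?_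
  simp [conjPoly]

theorem mapMatrix_conjPoly_const_diagonal {d : Fin N → ℂ} (hd : ∀ m, star (d m) = d m) :
    conjPoly.mapMatrix (const (diagonal d)) = const (diagonal d) := by
  refine mapMatrix_conjPoly_const fun i j => ?_
  by_cases h : i = j
  · simpa [h] using hd j
  · simp [h]

theorem mapMatrix_conjPoly_diagOp {β : Fin N → ℝ} {e d : Fin N → ℂ}
    (he : ∀ m, star (e m) = e m) (hd : ∀ m, star (d m) = d m) (k : Fin 3) :
    conjPoly.mapMatrix (diagOp β e d k) = diagOp β e d k := by
  have h : ∀ m, star (((β m : ℂ) + 1) * e m) = ((β m : ℂ) + 1) * e m := fun m => by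
    have := he m
    simp only [Complex.star_def] at this
    simp [this]
  fin_cases k
  · exact mapMatrix_conjPoly_const_diagonal hd
  · simp only [diagOp, Fin.mk_one, cons_val_one, cons_val_zero, map_sub, mapMatrix_conjPoly_X_smul,
      mapMatrix_conjPoly_const_diagonal h, mapMatrix_conjPoly_const_diagonal he]
  · simp only [diagOp, Fin.reduceFinMk, cons_val, mapMatrix_conjPoly_X_smul,
      mapMatrix_conjPoly_const_diagonal he]

theorem mapMatrix_conjPoly_shiftOp {β : Fin N → ℝ} {Y : Matrix (Fin N) (Fin N) ℂ}
    (hY : ∀ i j, star (Y i j) = Y i j) (k : Fin 3) :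
    conjPoly.mapMatrix (shiftOp β Y k) = shiftOp β Y k := by
  have hYt : conjPoly.mapMatrix (const Yᵀ) = const Yᵀ :=
    mapMatrix_conjPoly_const fun i j => hY j i
  have hβ : conjPoly.mapMatrix (const (diagonal fun m => (β m : ℂ)))
      = const (diagonal fun m => (β m : ℂ)) := mapMatrix_conjPoly_const_diagonal (by simp)
  fin_cases k
  · simp only [shiftOp, Fin.zero_eta, cons_val_zero, map_sub, mapMatrix_conjPoly_X_smul, const_mul,
      map_mul, hYt, hβ]
  · simp only [shiftOp, Fin.mk_one, cons_val_one, cons_val_zero, map_sub, mapMatrix_conjPoly_X_smul,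
      mapMatrix_conjPoly_const hY, hYt]
  · simp [shiftOp]

theorem diagonal_exponent (N : ℕ) (α : ℝ) :
    (diagonal fun m : Fin N => (exponent N α m : ℂ)) = (α : ℂ) • 1 + matJ N := by
  rw [matJ, smul_one_eq_diagonal, diagonal_add]
  congr 1
  funext m
  simp [exponent]

theorem diagonal_exponent_mul_matJ (N : ℕ) (α : ℝ) :
    (diagonal fun m : Fin N => ((exponent N α m : ℂ) + 1) * ((N : ℂ) - ((m : ℕ) + 1)))
      = ((1 + (α : ℂ)) • 1 + matJ N) * matJ N := by
  rw [matJ, smul_one_eq_diagonal, diagonal_add, diagonal_mul_diagonal]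
  congr 1
  funext m
  simp only [exponent]
  push_cast
  ring

theorem isSymmetric_opD₁ (hα : -1 < α) (ν : ℕ → ℝ) :
    IsSymmetric (opD₁ N α ν) (weight N α ν) := by
  have hA := matA_pow_card N ν
  have hJ := conjExp_const_of_lie_eq hA (matJ_mul_matA N ν)
  have hA' := conjExp_const_self hA
  have hlie : const (matJ N) * const (matA N ν)
      = const (matA N ν) * const (matJ N) + const (matA N ν) := by
    rw [← const_mul, matJ_mul_matA, const_add, const_mul]
  have hE2 : diagOp (exponent N α) 1 (fun m : Fin N => -((N : ℂ) - ((m : ℕ) + 1))) 2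
      = (X : ℂ[X]) • 1 := by
    simp only [diagOp, cons_val, Pi.one_def, diagonal_one, const_one]
  have hE1 : diagOp (exponent N α) 1 (fun m : Fin N => -((N : ℂ) - ((m : ℕ) + 1))) 1
      = (C (α : ℂ) + 1) • 1 + const (matJ N) - (X : ℂ[X]) • 1 := by
    have : (diagonal fun m : Fin N => (exponent N α m : ℂ) + 1)
        = ((α : ℂ) + 1) • 1 + matJ N := by
      rw [add_smul, add_right_comm, ← diagonal_exponent, one_smul, ← diagonal_one, diagonal_add]
    simp only [diagOp, cons_val_one, cons_val_zero, Pi.one_apply, mul_one, this, Pi.one_def,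
      diagonal_one, const_add, const_smul, const_one, C_add, C_1]
  have hE0 : diagOp (exponent N α) 1 (fun m : Fin N => -((N : ℂ) - ((m : ℕ) + 1))) 0
      = -const (matJ N) := by
    simp only [diagOp, cons_val_zero, ← const_neg, matJ, diagonal_neg]
  refine isSymmetric_weight hα ν (E := diagOp (exponent N α) 1 fun m => -((N : ℂ) - ((m : ℕ) + 1)))
    (applyRight_mul_expPoly hA ?_ ?_ ?_) (isDiagSymmetric_diagOp (neg_one_lt_exponent hα) _ _)
    (mapMatrix_conjPoly_diagOp (by simp) (by simp))
  · rw [hE2]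
    simp only [opD₁, cons_val, const_one, map_smul, map_one]
  · rw [hE1, hE2]
    simp only [opD₁, cons_val_one, cons_val_zero, const_add, const_smul, const_sub, const_one,
      map_add, map_sub, map_smul, map_one, hJ, hA', mul_smul_comm, mul_one]
    module
  · rw [hE0, hE1, hE2, ← conj_identity_one hlie]
    simp only [opD₁, cons_val_zero, const_sub, const_add, const_mul, const_smul, const_one,
      map_add, map_sub, map_mul, map_smul, map_one, hJ, hA']

theorem isSymmetric_opD₂ (hα : -1 < α) (ν : ℕ → ℝ) (hν : ∀ i, 1 ≤ i → i ≤ N - 1 → ν i ≠ 0)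
    (h : ∀ i : ℕ, 1 ≤ i → i ≤ N - 2 → (i : ℝ) * ((N : ℝ) - i) * ν (N - 1) ^ 2 =
      ((N : ℝ) - 1) * ν i ^ 2 + ((N : ℝ) - i - 1) * ν i ^ 2 * ν (N - 1) ^ 2) :
    IsSymmetric (opD₂ N α ν) (weight N α ν) := by
  have hA := matA_pow_card N ν
  have hJ := conjExp_const_of_lie_eq hA (matJ_mul_matA N ν)
  have hA' := conjExp_const_self hA
  have hY := conjExp_const_of_lie_eq_neg hA (matJ_mul_matA N ν) (matY_mul_matA_eq ν hν)
  have hYH := conjTranspose_matY_eq ν hν h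
  set c : ℂ := ((N : ℂ) - 1) / (ν (N - 1) : ℂ) ^ 2 with hc
  have hlie : const (matJ N) * const (matA N ν)
      = const (matA N ν) * const (matJ N) + const (matA N ν) := by
    rw [← const_mul, matJ_mul_matA, const_add, const_mul]
  have hlieY : const (matY N ν) * const (matA N ν)
      = const (matA N ν) * const (matY N ν) - (2 : ℂ[X]) • const (matJ N)
        + C ((N : ℂ) - 1) • 1 := by
    rw [← const_mul, matY_mul_matA_eq ν hν, const_add, const_sub, const_smul, const_smul,
      const_mul, const_one]
    rfl
  have hYt : const (matY N ν)ᵀ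
      = const (matA N ν) * (const (matJ N) + C c • 1) := by
    rw [transpose_matY_eq, hYH, const_mul, const_add, const_smul, const_one]
  set e : Fin N → ℂ := fun m => (N : ℂ) - ((m : ℕ) + 1) with he
  -- The diagonal of `cJ - AY`: the part of the conjugated zeroth-order coefficient not accounted
  -- for by `shiftOp`.
  set d : Fin N → ℂ := fun m => c * e m - ((m : ℂ) + 1) * e m with hd
  have he' : diagonal e = matJ N := rfl
  have hβe : (diagonal fun m => ((exponent N α m : ℂ) + 1) * e m)
      = ((1 + (α : ℂ)) • 1 + matJ N) * matJ N := diagonal_exponent_mul_matJ N α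
  have hd' : diagonal d = c • matJ N - matA N ν * matY N ν := by
    rw [matA_mul_matY ν hν, matJ, ← diagonal_smul, diagonal_sub]
    rfl
  have hE2 : (diagOp (exponent N α) e d + shiftOp (exponent N α) (matY N ν)) 2
      = (X : ℂ[X]) • const (matJ N) := by
    simp only [diagOp, shiftOp, Pi.add_apply, cons_val, add_zero, he']
  have hE1 : (diagOp (exponent N α) e d + shiftOp (exponent N α) (matY N ν)) 1
      = ((1 + C (α : ℂ)) • 1 + const (matJ N)) * const (matJ N) + const (matY N ν)
        - (X : ℂ[X]) • const (matJ N)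
        - (X : ℂ[X]) • (const (matA N ν) * (const (matJ N) + C c • 1)) := by
    simp only [diagOp, shiftOp, Pi.add_apply, cons_val_one, cons_val_zero, he', hYt, hβe,
      const_mul, const_add, const_smul, const_one, C_add, C_1]
    abel
  have hE0 : (diagOp (exponent N α) e d + shiftOp (exponent N α) (matY N ν)) 0
      = (X : ℂ[X]) • (const (matA N ν) * (const (matJ N) + C c • 1))
        - const (matA N ν) * (const (matJ N) + C c • 1) * (const (matJ N) + (C (α : ℂ) + 1) • 1)
        + (C c • const (matJ N) - const (matA N ν) * const (matY N ν)) := by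
    have hlie' : ∀ Z, const (matJ N) * (const (matA N ν) * Z)
        = const (matA N ν) * (const (matJ N) * Z) + const (matA N ν) * Z := fun Z => by
      rw [← mul_assoc, hlie, add_mul, mul_assoc]
    simp only [diagOp, shiftOp, Pi.add_apply, cons_val_zero, const_mul, hYt, hd', const_sub,
      const_smul, diagonal_exponent, const_add, mul_add, add_mul, mul_assoc, hlie,
      hlie', smul_mul_assoc, mul_smul_comm, one_mul, mul_one]
    module
  have hce : ∀ m, star (e m) = e m := by simp [he]
  have hcc : star c = c := by simp [hc]
  refine isSymmetric_weight hα ν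
    (E := diagOp (exponent N α) e d + shiftOp (exponent N α) (matY N ν))
    (applyRight_mul_expPoly hA ?_ ?_ ?_) ((isDiagSymmetric_diagOp (neg_one_lt_exponent hα) _ _).add
      (isDiagSymmetric_shiftOp (neg_one_lt_exponent hα) ?_)) fun k => ?_
  · rw [hE2]
    simp only [opD₂, cons_val, map_smul, map_sub, hJ, hA', add_sub_cancel_right]
  · rw [hE1, hE2]
    refine Eq.trans ?_ (conj_identity_two (c := C c) hlie hlieY)
    simp only [opD₂, cons_val_one, cons_val_zero, hYH]
    simp only [const_add, const_sub, const_mul, const_smul, const_one, map_add, map_sub, map_mul,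
      map_smul, map_one, hJ, hA', hY]
    rfl
  · rw [hE0, hE1, hE2]
    refine Eq.trans ?_ (conj_identity_three (c := C c) hlie)
    simp only [opD₂, cons_val_zero, ← hc]
    simp only [const_add, const_sub, const_mul, const_smul, const_one, map_add, map_sub, map_mul,
      map_smul, map_one, hJ, hA']
  -- `Y` lives on the subdiagonal, and the exponents drop by one as the index grows by one.
  · intro l m hlm
    have : (l : ℕ) = m + 1 := by
      by_contra hne
      exact hlm (by simp [matY, hne])
    rw [exponent, exponent, this]
    push_cast
    ring
  · rw [Pi.add_apply, map_add, mapMatrix_conjPoly_diagOp hce, mapMatrix_conjPoly_shiftOp]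
    · intro i j
      rw [matY, of_apply]
      split_ifs <;> simp
    · intro m
      have := hce m
      simp only [Complex.star_def] at this hcc
      simp [hd, this, hcc]

end Symmetry

/-! ### Positivity and the point mass -/

section Positivity

variable {N : ℕ} {α : ℝ}

theorem conjTranspose_diagForm_conjPoly {β : Fin N → ℝ} (hβ : ∀ m, -1 < β m) (R : MatPoly N) :
    (diagForm β R (conjPoly.mapMatrix R))ᴴ = diagForm β R (conjPoly.mapMatrix R) := by
  have hL : ∀ (m : Fin N) (p q : ℂ[X]), star (laguerre (β m) (p * conjPoly q))
      = laguerre (β m) (q * conjPoly p) := by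
    intro m p q
    rw [laguerre_eq_integral (hβ m), laguerre_eq_integral (hβ m), Complex.star_def, ← integral_conj]
    congr 1
    funext t
    rw [eval_mul, eval_mul, eval_conjPoly, eval_conjPoly, map_mul, laguerreDensity,
      Complex.conj_ofReal]
    simp [mul_comm]
  ext i j
  rw [conjTranspose_apply, diagForm_apply, diagForm_apply, star_sum]
  exact Finset.sum_congr rfl fun m _ => hL m _ _

/-- The quadratic form at `x` is the sum of the squared Laguerre norms of the components of `x^* R`,
positive once one component is nonzero. -/
theorem posDef_diagForm_conjPoly {β : Fin N → ℝ} (hβ : ∀ m, -1 < β m) {R : MatPoly N}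
    (hR : ∀ x : Fin N → ℂ, x ≠ 0 → (fun i => C (x i)) ᵥ* R ≠ 0) :
    (diagForm β R (conjPoly.mapMatrix R)).PosDef := by
  refine PosDef.of_dotProduct_mulVec_pos (conjTranspose_diagForm_conjPoly hβ R) fun {x} hx => ?_
  have key : star x ⬝ᵥ (diagForm β R (conjPoly.mapMatrix R) *ᵥ x)
      = ∑ m, laguerre (β m) (((fun i => C (star x i)) ᵥ* R) m
        * conjPoly (((fun i => C (star x i)) ᵥ* R) m)) := by
    have hq : ∀ m, ((fun i => C (star x i)) ᵥ* R) m * conjPoly (((fun i => C (star x i)) ᵥ* R) m)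
        = ∑ i, ∑ j, (star (x i) * x j) • (R i m * conjPoly (R j m)) := fun m => by
      simp only [vecMul, dotProduct, map_sum, map_mul, Finset.sum_mul_sum]
      refine Finset.sum_congr rfl fun i _ => Finset.sum_congr rfl fun j _ => ?_
      have hc : conjPoly (C (star x j)) = C (x j) := by simp [conjPoly]
      rw [hc, smul_eq_C_mul, C_mul, Pi.star_apply]
      ring
    simp only [hq, map_sum, map_smul, smul_eq_mul]
    simp only [dotProduct, mulVec, diagForm_apply, Finset.mul_sum, Finset.sum_mul, Pi.star_apply]
    symm
    rw [Finset.sum_comm]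
    refine Finset.sum_congr rfl fun i _ => ?_
    rw [Finset.sum_comm]
    refine Finset.sum_congr rfl fun j _ => Finset.sum_congr rfl fun m _ => ?_
    rw [RingHom.mapMatrix_apply, map_apply]
    ring
  rw [key]
  have hx' : star x ≠ 0 := star_ne_zero.2 hx
  obtain ⟨m, hm⟩ := Function.ne_iff.1 (hR _ hx')
  exact Finset.sum_pos' (fun m _ => laguerre_mul_conjPoly_nonneg (hβ m) _)
    ⟨m, Finset.mem_univ _, laguerre_mul_conjPoly_pos (hβ m) hm⟩

/-- Cancelling the invertible `e^{At}` leaves `xP = 0`, and the coefficient of degree `n` then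
forces `x = 0`. -/
theorem C_vecMul_mul_expPoly_ne_zero {A : Matrix (Fin N) (Fin N) ℂ} (hA : A ^ N = 0) {n : ℕ}
    {P : MatPoly N} (hP : IsUnit (P.map fun p => p.coeff n)) {x : Fin N → ℂ} (hx : x ≠ 0) :
    (fun i => C (x i)) ᵥ* (P * expPoly A) ≠ 0 := by
  intro h
  have h1 : (fun i => C (x i)) ᵥ* P = 0 := by
    have := congrArg (fun r => r ᵥ* expPoly (-A)) h
    simpa only [vecMul_vecMul, mul_assoc, expPoly_mul_expPoly_neg hA, mul_one,
      zero_vecMul] using this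
  refine hx (vecMul_injective_of_isUnit hP ?_)
  beta_reduce
  rw [zero_vecMul]
  funext j
  have := congrArg (fun p => p.coeff n) (congrFun h1 j)
  simpa [vecMul, dotProduct, finsetSum_coeff] using this

theorem posSemidef_density (N : ℕ) (α : ℝ) (ν : ℕ → ℝ) {t : ℝ} (ht : 0 < t) :
    (density N α ν t).PosSemidef := by
  have h : (0 : ℂ) ≤ ((t ^ α * Real.exp (-t) : ℝ) : ℂ) := by
    rw [Complex.zero_le_real]
    positivity
  have h2 : matPow t ((1 / 2 : ℂ) • (matJ N)ᴴ) = (matPow t ((1 / 2 : ℂ) • matJ N))ᴴ := by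
    rw [matPow, matPow, ← exp_conjTranspose, conjTranspose_smul, conjTranspose_smul]
    simp
  have h3 : NormedSpace.exp ((t : ℂ) • (matA N ν)ᴴ) = (NormedSpace.exp ((t : ℂ) • matA N ν))ᴴ := by
    rw [← exp_conjTranspose, conjTranspose_smul]
    simp
  rw [density, h2, h3]
  refine PosSemidef.smul ?_ h
  rw [mul_assoc _ _ (NormedSpace.exp _)ᴴ, ← conjTranspose_mul]
  exact posSemidef_self_mul_conjTranspose _

theorem posSemidef_integral {X : Type*} [MeasurableSpace X] {μ : Measure X}
    {w : X → Matrix (Fin N) (Fin N) ℂ} (hw : ∀ i j, Integrable (fun t => w t i j) μ)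
    (hp : ∀ᵐ t ∂μ, (w t).PosSemidef) : (Matrix.of fun i j => ∫ t, w t i j ∂μ).PosSemidef := by
  refine PosSemidef.of_dotProduct_mulVec_nonneg ?_ fun x => ?_
  · ext i j
    rw [conjTranspose_apply, of_apply, of_apply, Complex.star_def, ← integral_conj]
    refine integral_congr_ae ?_
    filter_upwards [hp] with t ht
    exact ht.isHermitian.apply i j
  · have key : star x ⬝ᵥ ((Matrix.of fun i j => ∫ t, w t i j ∂μ) *ᵥ x)
        = ∫ t, star x ⬝ᵥ (w t *ᵥ x) ∂μ := by
      simp only [dotProduct, mulVec, of_apply]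
      rw [integral_finsetSum _ fun i _ =>
        (integrable_finsetSum _ fun j _ => (hw i j).mul_const _).const_mul _]
      refine Finset.sum_congr rfl fun i _ => ?_
      rw [integral_const_mul, integral_finsetSum _ fun j _ => (hw i j).mul_const _]
      congr 1
      exact Finset.sum_congr rfl fun j _ => (integral_mul_const _ _).symm
    rw [key]
    refine integral_nonneg_of_ae ?_
    filter_upwards [hp] with t ht
    exact ht.dotProduct_mulVec_nonneg x

theorem posSemidef_weight (hα : -1 < α) (ν : ℕ → ℝ) {Ω : Set ℝ} (hΩ : MeasurableSet Ω) :
    ((weight N α ν).map fun m => m Ω).PosSemidef := by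
  have : ((weight N α ν).map fun m => m Ω) = Matrix.of fun i j =>
      ∫ t, density N α ν t i j ∂((volume.restrict (Set.Ioi 0)).restrict Ω) := by
    ext i j
    exact withDensityᵥ_apply (integrableOn_density hα ν i j) hΩ
  rw [this]
  refine posSemidef_integral (fun i j => Integrable.restrict (integrableOn_density hα ν i j)) ?_
  refine ae_restrict_of_ae ?_
  filter_upwards [ae_restrict_mem measurableSet_Ioi] with t ht
  exact posSemidef_density N α ν ht

theorem posSemidef_diracMass {M : Matrix (Fin N) (Fin N) ℂ} (hM : M.PosSemidef) (t₀ : ℝ)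
    {Ω : Set ℝ} (hΩ : MeasurableSet Ω) : ((diracMass t₀ M).map fun m => m Ω).PosSemidef := by
  by_cases h : t₀ ∈ Ω
  · have : ((diracMass t₀ M).map fun m => m Ω) = M := by
      ext i j
      exact VectorMeasure.dirac_apply_of_mem hΩ h
    rwa [this]
  · have : ((diracMass t₀ M).map fun m => m Ω) = 0 := by
      ext i j
      exact VectorMeasure.dirac_apply_of_notMem h
    rw [this]
    exact PosSemidef.zero

theorem integrable_diracMass (t₀ : ℝ) (M : Matrix (Fin N) (Fin N) ℂ) (f : ℝ → ℂ) (i j : Fin N) :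
    (diracMass t₀ M i j).Integrable f := by
  rw [VectorMeasure.Integrable, diracMass, map_apply, VectorMeasure.variation_dirac]
  exact (integrable_dirac (by simp)).smul_measure enorm_ne_top

theorem form_add_smul_diracMass (hα : -1 < α) (ν : ℕ → ℝ) (γ ζ : ℝ) (M : Matrix (Fin N) (Fin N) ℂ)
    (P Q : MatPoly N) :
    form (γ • weight N α ν + ζ • diracMass 0 M) P Q = (γ : ℂ) • form (weight N α ν) P Q
      + (ζ : ℂ) • ((evalRingHom 0).mapMatrix P * M * ((evalRingHom 0).mapMatrix Q)ᴴ) := by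
  ext i j
  have h : ∀ k l, ((γ • weight N α ν + ζ • diracMass 0 M) k l).integral
      (fun t : ℝ => (P i k).eval (t : ℂ) * star ((Q j l).eval (t : ℂ)))
      (ContinuousLinearMap.mul ℝ ℂ)
      = γ * (weight N α ν k l).integral
        (fun t : ℝ => (P i k).eval (t : ℂ) * star ((Q j l).eval (t : ℂ)))
        (ContinuousLinearMap.mul ℝ ℂ)
        + ζ * ((P i k).eval 0 * M k l * star ((Q j l).eval 0)) := by
    intro k l
    rw [eval_mul_star_eval]
    rw [Matrix.add_apply, Matrix.smul_apply, Matrix.smul_apply,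
      VectorMeasure.integral_add_vectorMeasure
        ((integrable_weight hα ν _ k l).smul_vectorMeasure γ)
        ((integrable_diracMass 0 M _ k l).smul_vectorMeasure ζ),
      VectorMeasure.integral_smul_vectorMeasure, VectorMeasure.integral_smul_vectorMeasure]
    rw [diracMass, map_apply, VectorMeasure.integral_dirac, ContinuousLinearMap.mul_apply',
      eval_mul, eval_conjPoly, Complex.real_smul, Complex.real_smul, Complex.ofReal_zero]
    ring
  rw [form, of_apply]
  simp only [h, Finset.sum_add_distrib, ← Finset.mul_sum]
  rw [Matrix.add_apply, Matrix.smul_apply, Matrix.smul_apply, smul_eq_mul, smul_eq_mul, form,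
    of_apply]
  simp only [mul_apply, Finset.sum_mul, conjTranspose_apply, RingHom.mapMatrix_apply, map_apply,
    coe_evalRingHom]
  congr 2
  exact Finset.sum_comm

theorem isWeightMatrix_add_diracMass (hα : -1 < α) (ν : ℕ → ℝ) {M : Matrix (Fin N) (Fin N) ℂ}
    (hM : M.PosSemidef) {γ ζ : ℝ} (hγ : 0 < γ) (hζ : 0 ≤ ζ) :
    IsWeightMatrix (γ • weight N α ν + ζ • diracMass 0 M) where
  posSemidef Ω hΩ := by
    have : ((γ • weight N α ν + ζ • diracMass 0 M).map fun m => m Ω)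
        = γ • ((weight N α ν).map fun m => m Ω) + ζ • ((diracMass 0 M).map fun m => m Ω) := by
      ext i j
      simp
    rw [this]
    exact ((posSemidef_weight hα ν hΩ).smul hγ.le).add ((posSemidef_diracMass hM 0 hΩ).smul hζ)
  moments n i j := by
    have := integrable_weight hα ν (X ^ n) i j
    simp only [eval_pow, eval_X] at this
    exact (this.smul_vectorMeasure γ).add_vectorMeasure
      ((integrable_diracMass 0 M _ i j).smul_vectorMeasure ζ)
  nonsingular n P _ hP := by
    rw [form_add_smul_diracMass hα, form_weight hα]
    refine PosDef.isUnit (PosDef.add_posSemidef (PosDef.smul ?_ ?_) (PosSemidef.smul ?_ ?_))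
    · exact posDef_diagForm_conjPoly (neg_one_lt_exponent hα) fun x hx =>
        C_vecMul_mul_expPoly_ne_zero (matA_pow_card N ν) hP hx
    · exact_mod_cast hγ
    · exact hM.mul_mul_conjTranspose_same _
    · exact_mod_cast hζ

end Positivity

/-! ### The vector `v` and the mass matrix -/

section Mass

variable {N : ℕ}

/-- Reindexing by `k ↦ N - k` makes the left side a product over `[a, N)`, which is split at `b`. -/
theorem prod_vecV_factor_eq (N : ℕ) (α : ℝ) (ν : ℕ → ℝ) {a b : ℕ} (hab : a ≤ b) (hb : b ≤ N) :
    ∏ k ∈ Finset.Icc 1 (N - a), (ν (N - k) : ℂ) * ((α : ℂ) + k) / k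
      = (∏ k ∈ Finset.Ico a b, (ν k : ℂ) * ((α : ℂ) + N - k) / ((N : ℂ) - k))
        * ∏ k ∈ Finset.Icc 1 (N - b), (ν (N - k) : ℂ) * ((α : ℂ) + k) / k := by
  induction b, hab using Nat.le_induction with
  | base => simp
  | succ b hab ih =>
    rw [ih (by omega), Finset.prod_Ico_succ_top hab, mul_assoc]
    congr 1
    rw [show N - b = N - (b + 1) + 1 by omega, Finset.prod_Icc_succ_top (by omega), mul_comm]
    congr 1
    have h1 : N - (N - (b + 1) + 1) = b := by omega
    have h2 : ((N - (b + 1) + 1 : ℕ) : ℂ) = N - b := by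
      rw [show N - (b + 1) + 1 = N - b by omega, Nat.cast_sub (by omega)]
    rw [h1, h2]
    ring

theorem star_vecV (N : ℕ) (α : ℝ) (ν : ℕ → ℝ) : star (vecV N α ν) = vecV N α ν := by
  funext j
  simp [vecV]

theorem massM_apply (α : ℝ) (ν : ℕ → ℝ) (i j : Fin N) : massM N α ν i j =
    (∏ k ∈ Finset.Ico (min ((i : ℕ) + 1) ((j : ℕ) + 1)) (max ((i : ℕ) + 1) ((j : ℕ) + 1)),
      (ν k : ℂ) * ((α : ℂ) + N - k) / ((N : ℂ) - k)) *
    (∏ k ∈ Finset.Icc 1 (N - max ((i : ℕ) + 1) ((j : ℕ) + 1)),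
      (ν (N - k) : ℂ) * ((α : ℂ) + k) / k) ^ 2 := by
  rw [massM, star_vecV, vecMulVec_apply]
  rcases le_total ((i : ℕ) + 1) ((j : ℕ) + 1) with h | h
  · rw [min_eq_left h, max_eq_right h, vecV, vecV, prod_vecV_factor_eq N α ν h (by omega)]
    ring
  · rw [min_eq_right h, max_eq_left h, vecV, vecV, prod_vecV_factor_eq N α ν h (by omega)]
    ring

theorem vecV_succ_eq (α : ℝ) (ν : ℕ → ℝ) {i j : Fin N} (h : (j : ℕ) = i + 1) :
    ((N : ℂ) - ((i : ℂ) + 1)) * vecV N α ν i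
      = (ν (i + 1) : ℂ) * ((α : ℂ) + N - ((i : ℂ) + 1)) * vecV N α ν j := by
  have hj := j.2
  have hne : (N : ℂ) - ((i : ℂ) + 1) ≠ 0 := by
    rw [sub_ne_zero]
    exact_mod_cast (by omega : N ≠ i + 1)
  rw [vecV, vecV, prod_vecV_factor_eq N α ν (a := i + 1) (b := i + 2) (by omega) (by omega), h,
    show (i : ℕ) + 2 = i + 1 + 1 by rfl, Nat.Ico_succ_singleton, Finset.prod_singleton]
  push_cast
  field_simp

end Mass

/-! ### The operator `D` and its annihilation of the mass -/

section Combination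

variable {N : ℕ} {α : ℝ}

theorem form_smul_left (hα : -1 < α) (ν : ℕ → ℝ) (c : ℂ) (P Q : MatPoly N) :
    form (weight N α ν) (c • P) Q = c • form (weight N α ν) P Q := by
  rw [form_weight hα, form_weight hα]
  ext i j
  simp only [diagForm_apply, Matrix.smul_apply, smul_mul_assoc, map_smul, Finset.smul_sum]

theorem form_smul_right (hα : -1 < α) (ν : ℕ → ℝ) (c : ℂ) (P Q : MatPoly N) :
    form (weight N α ν) P (c • Q) = star c • form (weight N α ν) P Q := by
  rw [form_weight hα, form_weight hα]
  ext i j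
  simp only [diagForm_apply, Matrix.smul_apply, smul_mul_assoc, RingHom.mapMatrix_apply, map_apply,
    Finset.smul_sum]
  refine Finset.sum_congr rfl fun m _ => ?_
  have : ∀ p, conjPoly (c • p) = star c • conjPoly p := by simp [conjPoly]
  rw [this, mul_smul_comm, map_smul]

theorem form_add_left (hα : -1 < α) (ν : ℕ → ℝ) (P P' Q : MatPoly N) :
    form (weight N α ν) (P + P') Q = form (weight N α ν) P Q + form (weight N α ν) P' Q := by
  rw [form_weight hα, form_weight hα, form_weight hα, add_mul, diagForm_add_left]

theorem form_add_right (hα : -1 < α) (ν : ℕ → ℝ) (P Q Q' : MatPoly N) :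
    form (weight N α ν) P (Q + Q') = form (weight N α ν) P Q + form (weight N α ν) P Q' := by
  rw [form_weight hα, form_weight hα, form_weight hα, add_mul, map_add, diagForm_add_right]

theorem isSymmetric_smul_add (hα : -1 < α) (ν : ℕ → ℝ) {D D' : DiffOp 2 N} {c : ℂ} (hc : star c = c)
    (hD : IsSymmetric D (weight N α ν)) (hD' : IsSymmetric D' (weight N α ν)) :
    IsSymmetric (c • D + D') (weight N α ν) := fun P Q => by
  rw [applyRight_add, applyRight_add, applyRight_smul, applyRight_smul, form_add_left hα,
    form_add_right hα, form_smul_left hα, form_smul_right hα, hc, hD, hD']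

theorem opD_one (N : ℕ) (α : ℝ) (ν : ℕ → ℝ) (hν : ∀ i, 1 ≤ i → i ≤ N - 1 → ν i ≠ 0) :
    opD N α ν 1 = const (matY N ν - Matrix.diagonal fun i : Fin N =>
        ((i : ℕ) : ℂ) * ((α : ℂ) + N - (i : ℕ))) +
      (X : ℂ[X]) • const (matJ N - ((α : ℂ) + N + 1) • matA N ν - (matY N ν)ᴴ) := by
  -- The right side is `((α+1)I + J)((N-1)I - J)`, and the entries of `(N-1)I - J` are the
  -- zero-based indices.
  have hd : (Matrix.diagonal fun i : Fin N => ((i : ℕ) : ℂ) * ((α : ℂ) + N - (i : ℕ)))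
      = ((N : ℂ) - 1) • (((α : ℂ) + 1) • 1 + matJ N)
        - ((1 + (α : ℂ)) • 1 + matJ N) * matJ N := by
    rw [matJ, smul_one_eq_diagonal, smul_one_eq_diagonal, diagonal_add, diagonal_add,
      diagonal_mul_diagonal, ← diagonal_smul, diagonal_sub]
    congr 1
    funext i
    simp only [Pi.smul_apply, smul_eq_mul]
    ring
  have hs : ∀ (c : ℂ) (P : MatPoly N), c • P = C c • P := fun c P => by
    ext i j : 2
    simp
  rw [hd]
  simp only [opD, Pi.add_apply, Pi.smul_apply, opD₁, opD₂, cons_val_one, cons_val_zero]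
  rw [hs, show matJ N + ((α : ℂ) + 2) • matA N ν + (matY N ν)ᴴ - matA N ν * matY N ν
    + matY N ν * matA N ν = ((α : ℂ) + 2) • matA N ν + (matY N ν)ᴴ - matJ N
      + ((N : ℂ) - 1) • 1 by rw [matY_mul_matA_eq ν hν]; module]
  simp only [const_add, const_sub, const_smul, const_one, C_add, C_sub, C_neg, C_1]
  have h2 : (C 2 : ℂ[X]) = 2 := rfl
  rw [h2]
  module

theorem opD_two (N : ℕ) (α : ℝ) (ν : ℕ → ℝ) :
    opD N α ν 2 = (X : ℂ[X]) • (const (-((N : ℂ) - 1) • 1 + matJ N) -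
      (X : ℂ[X]) • const (matA N ν)) := by
  have hs : ∀ (c : ℂ) (P : MatPoly N), c • P = C c • P := fun c P => by
    ext i j : 2
    simp
  simp only [opD, Pi.add_apply, Pi.smul_apply, opD₁, opD₂, cons_val]
  rw [hs]
  simp only [const_add, const_smul, const_one]
  module

theorem opD_zero (N : ℕ) (α : ℝ) (ν : ℕ → ℝ) (hν : ν (N - 1) ≠ 0) :
    opD N α ν 0 = const ((((N : ℂ) - 1) * (1 + (ν (N - 1) : ℂ) ^ 2) / (ν (N - 1) : ℂ) ^ 2) •
      (matJ N - ((α : ℂ) • 1 + matJ N) * matA N ν)) := by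
  have hs : ∀ (c : ℂ) (B : Matrix (Fin N) (Fin N) ℂ), c • const B = const (c • B) := fun c B => by
    ext i j : 2
    simp [const]
  have hν' : (ν (N - 1) : ℂ) ≠ 0 := by exact_mod_cast hν
  simp only [opD, Pi.add_apply, Pi.smul_apply, opD₁, opD₂, cons_val_zero]
  rw [hs, ← const_add, show ((N : ℂ) - 1) * (1 + (ν (N - 1) : ℂ) ^ 2) / (ν (N - 1) : ℂ) ^ 2
    = ((N : ℂ) - 1) + ((N : ℂ) - 1) / (ν (N - 1) : ℂ) ^ 2 by field_simp; ring]
  congr 1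
  rw [add_comm (matJ N)]
  module

/-- The columns of `M` are multiples of `v^*`; each row but the first is the recurrence
`vecV_succ_eq` multiplied by `i / ν_i`, and the first row is zero. -/
theorem matY_sub_diagonal_mul_massM (α : ℝ) (ν : ℕ → ℝ)
    (hν : ∀ i, 1 ≤ i → i ≤ N - 1 → ν i ≠ 0) :
    (matY N ν - Matrix.diagonal fun i : Fin N => ((i : ℕ) : ℂ) * ((α : ℂ) + N - (i : ℕ)))
      * massM N α ν = 0 := by
  rw [massM, star_vecV, mul_vecMulVec]
  suffices h : (matY N ν - Matrix.diagonal fun i : Fin N => ((i : ℕ) : ℂ) * ((α : ℂ) + N - (i : ℕ)))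
      *ᵥ vecV N α ν = 0 by rw [h, zero_vecMulVec]
  funext i
  rw [sub_mulVec, Pi.sub_apply, mulVec_diagonal, Pi.zero_apply, sub_eq_zero, mulVec, dotProduct]
  by_cases hi : 1 ≤ (i : ℕ)
  · have hj : (i : ℕ) = ((⟨i - 1, by omega⟩ : Fin N) : ℕ) + 1 := by simp; omega
    rw [Finset.sum_eq_single ⟨i - 1, by omega⟩]
    · have h := vecV_succ_eq α ν hj
      have h0 : (ν i : ℂ) ≠ 0 := by exact_mod_cast hν i (by omega) (by omega)
      have h1 : (i : ℕ) - 1 + 1 = i := by omega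
      have h2 : (((i : ℕ) - 1 : ℕ) : ℂ) + 1 = i := by exact_mod_cast h1
      simp only [h1, h2] at h
      simp only [matY, of_apply, h1, h2, if_true]
      field_simp
      linear_combination h
    · intro k _ hk
      have : ¬ (i : ℕ) = k + 1 := fun h' => hk (Fin.ext (by simp; omega))
      simp [matY, this]
    · simp
  · have h0 : (i : ℕ) = 0 := by omega
    rw [Finset.sum_eq_zero]
    · simp [h0]
    · intro k _
      have : ¬ (i : ℕ) = k + 1 := by omega
      simp [matY, this]

theorem matJ_sub_mul_massM (N : ℕ) (α : ℝ) (ν : ℕ → ℝ) :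
    (matJ N - ((α : ℂ) • 1 + matJ N) * matA N ν) * massM N α ν = 0 := by
  rw [massM, star_vecV, mul_vecMulVec]
  suffices h : (matJ N - ((α : ℂ) • 1 + matJ N) * matA N ν) *ᵥ vecV N α ν = 0 by
    rw [h, zero_vecMulVec]
  funext i
  rw [sub_mulVec, Pi.sub_apply, Pi.zero_apply, sub_eq_zero, ← mulVec_mulVec, matJ,
    smul_one_eq_diagonal, diagonal_add, mulVec_diagonal, mulVec_diagonal, mulVec, dotProduct]
  by_cases hi : (i : ℕ) + 1 < N
  · rw [Finset.sum_eq_single ⟨i + 1, hi⟩]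
    · have h := vecV_succ_eq α ν (i := i) (j := ⟨i + 1, hi⟩) rfl
      simp only [matA, of_apply, if_true]
      linear_combination h
    · intro k _ hk
      have : ¬ (k : ℕ) = i + 1 := fun h' => hk (Fin.ext h')
      simp [matA, this]
    · simp
  · have hN : (N : ℂ) = i + 1 := by
      have := i.2
      exact_mod_cast (by omega : N = i + 1)
    rw [Finset.sum_eq_zero]
    · simp [hN]
    · intro k _
      have : ¬ (k : ℕ) = i + 1 := by omega
      simp [matA, this]

/-- Coefficients stand to the right of `P`, so `(PD)(0) M = 0`; taking adjoints kills the other side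
too. -/
theorem isSymmetric_add_diracMass (hα : -1 < α) (ν : ℕ → ℝ) {D : DiffOp 2 N}
    {M : Matrix (Fin N) (Fin N) ℂ} (hM : M.IsHermitian) (hD : IsSymmetric D (weight N α ν))
    (h : ∀ k, (evalRingHom 0).mapMatrix (D k) * M = 0) (γ ζ : ℝ) :
    IsSymmetric D (γ • weight N α ν + ζ • diracMass 0 M) := fun P Q => by
  have hz : ∀ P : MatPoly N, (evalRingHom 0).mapMatrix (applyRight P D) * M = 0 := fun P => by
    rw [applyRight_two]
    simp only [map_add, map_mul, add_mul, mul_assoc, h, mul_zero, add_zero]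
  have hz' : M * ((evalRingHom 0).mapMatrix (applyRight Q D))ᴴ = 0 := by
    rw [← hM.eq, ← conjTranspose_mul, hz, conjTranspose_zero]
  rw [form_add_smul_diracMass hα, form_add_smul_diracMass hα, hD, hz, zero_mul, mul_assoc _ M, hz',
    mul_zero]

end Combination

end MatrixWeight

/-! ### Assembly -/

theorem mainTheorem6 (N : ℕ) (hN : 2 ≤ N) (α : ℝ) (hα : -1 < α) (ν : ℕ → ℝ)
    (hν : ∀ i, 1 ≤ i → i ≤ N - 1 → ν i ≠ 0) :
    (∀ i j, IntegrableOn (fun t => density N α ν t i j) (Set.Ioi 0)) ∧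
    IsWeightMatrix (weight N α ν) ∧
    IsSymmetric (opD₁ N α ν) (weight N α ν) ∧
    (massM N α ν).PosSemidef ∧ (massM N α ν).det = 0 ∧
    (∀ i j : Fin N, massM N α ν i j =
      (∏ k ∈ Finset.Ico (min ((i : ℕ) + 1) ((j : ℕ) + 1)) (max ((i : ℕ) + 1) ((j : ℕ) + 1)),
        (ν k : ℂ) * ((α : ℂ) + N - k) / ((N : ℂ) - k)) *
      (∏ k ∈ Finset.Icc 1 (N - max ((i : ℕ) + 1) ((j : ℕ) + 1)),
        (ν (N - k) : ℂ) * ((α : ℂ) + k) / k) ^ 2) ∧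
    ((∀ i : ℕ, 1 ≤ i → i ≤ N - 2 →
        (i : ℝ) * ((N : ℝ) - i) * ν (N - 1) ^ 2 =
          ((N : ℝ) - 1) * ν i ^ 2 + ((N : ℝ) - i - 1) * ν i ^ 2 * ν (N - 1) ^ 2) →
      IsSymmetric (opD₂ N α ν) (weight N α ν) ∧
      opD N α ν 2 = (X : ℂ[X]) • (const (-((N : ℂ) - 1) • 1 + matJ N) -
        (X : ℂ[X]) • const (matA N ν)) ∧
      opD N α ν 1 = const (matY N ν - Matrix.diagonal fun i : Fin N =>
          ((i : ℕ) : ℂ) * ((α : ℂ) + N - (i : ℕ))) +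
        (X : ℂ[X]) • const (matJ N - ((α : ℂ) + N + 1) • matA N ν - (matY N ν)ᴴ) ∧
      opD N α ν 0 = const ((((N : ℂ) - 1) * (1 + (ν (N - 1) : ℂ) ^ 2) / (ν (N - 1) : ℂ) ^ 2) •
        (matJ N - ((α : ℂ) • 1 + matJ N) * matA N ν)) ∧
      ∀ γ ζ : ℝ, 0 < γ → 0 ≤ ζ →
        IsWeightMatrix (γ • weight N α ν + ζ • diracMass 0 (massM N α ν)) ∧
        IsSymmetric (opD N α ν) (γ • weight N α ν + ζ • diracMass 0 (massM N α ν))) := by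
  -- A rank-one matrix is singular only in size at least two.
  have : Nontrivial (Fin N) := Fin.nontrivial_iff_two_le.2 hN
  have hM : (massM N α ν).PosSemidef := posSemidef_vecMulVec_star_self _
  have hW : IsWeightMatrix (weight N α ν) := by
    -- The weight itself is the case `γ = 1`, `ζ = 0`.
    have h : (1 : ℝ) • weight N α ν + (0 : ℝ) • diracMass 0 (massM N α ν) = weight N α ν := by
      refine Matrix.ext fun i j => VectorMeasure.ext fun s _ => ?_
      simp
    exact h ▸ isWeightMatrix_add_diracMass hα ν hM one_pos le_rfl
  refine ⟨integrableOn_density hα ν, hW, isSymmetric_opD₁ hα ν, hM, det_vecMulVec _ _,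
    massM_apply α ν, fun h => ?_⟩
  have hD₂ := isSymmetric_opD₂ hα ν hν h
  have hF₂ := opD_two N α ν
  have hF₁ := opD_one N α ν hν
  have hF₀ := opD_zero N α ν (hν _ (by omega) le_rfl)
  refine ⟨hD₂, hF₂, hF₁, hF₀, fun γ ζ hγ hζ => ⟨isWeightMatrix_add_diracMass hα ν hM hγ hζ, ?_⟩⟩
  refine isSymmetric_add_diracMass hα ν hM.isHermitian
    (isSymmetric_smul_add hα ν (by simp) (isSymmetric_opD₁ hα ν) hD₂) (fun k => ?_) γ ζ
  have hX : ∀ P : MatPoly N, (evalRingHom 0).mapMatrix ((X : ℂ[X]) • P) = 0 := fun P => by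
    rw [← mul_one X]
    exact mapMatrix_eval_zero_X_smul 1 P
  change (evalRingHom 0).mapMatrix (opD N α ν k) * massM N α ν = 0
  fin_cases k
  · change (evalRingHom 0).mapMatrix (opD N α ν 0) * massM N α ν = 0
    rw [hF₀, mapMatrix_eval_zero_const, smul_mul_assoc, matJ_sub_mul_massM, smul_zero]
  · change (evalRingHom 0).mapMatrix (opD N α ν 1) * massM N α ν = 0
    rw [hF₁, map_add, mapMatrix_eval_zero_const, hX, add_zero, matY_sub_diagonal_mul_massM α ν hν]
  · change (evalRingHom 0).mapMatrix (opD N α ν 2) * massM N α ν = 0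
    rw [hF₂, hX, zero_mul]
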